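/- Let $\mathcal S,\mathcal A$ be countable state and action spaces, with transition probabilities $P(\cdot\mid s,a)$, rewards $r(s,a)\in[0,1]$ and discount factor $\gamma\in[0,1)$. Let $\pi$ be a policy, let $P_\pi(s'\mid s)=\mathbb E_{a\sim\pi(\cdot\mid s)}P(s'\mid s,a)$, suppose that $P_\pi$ has a unique stationary distribution $\mu$, put $r(s)=\mathbb E_{a\sim\pi(\cdot\mid s)}r(s,a)$, and let $\phi:\mathcal S\to\mathbb R^d$ be a feature map with $\|\phi(s)\|_2\le 1$ for all $s$. Put $$A=\mathbb E_{s\sim\mu,\,s'\sim P_\pi(\cdot\mid s)}\big[\phi(s)(\phi(s)-\gamma\phi(s'))^\top\big],\quad b=\mathbb E_{s\sim\mu}[r(s)\phi(s)],\quad \theta^\star=A^{-1}b,\quad \lambda_0=\lambda_{\min}\big(\mathbb E_{s\sim\mu}[\phi(s)\phi(s)^\top]\big),$$ and assume $\lambda_0>0$. Let $(s_t,a_t,s_t')$, $t\ge1$, be i.i.d. with $s_t\sim\mu$, $a_t\sim\pi(\cdot\mid s_t)$, $s_t'\sim P(\cdot\mid s_t,a_t)$, and put $A_t=\phi(s_t)(\phi(s_t)-\gamma\phi(s_t'))^\top$,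 $b_t=r(s_t,a_t)\phi(s_t)$, $$\Gamma=\mathbb E\big[(A_t\theta^\star-b_t)(A_t\theta^\star-b_t)^\top\big],\qquad \Lambda^\star=A^{-1}\Gamma A^{-\top},$$ and assume that $\Gamma$ is invertible. Let $\theta_0\in\mathbb R^d$ be deterministic and, for $t\ge 1$, let $\theta_t=\theta_{t-1}-\eta_t(A_t\theta_{t-1}-b_t)$ with $\eta_t=\eta_0t^{-\alpha}$, where $0<\eta_0<1/2$ and $1/2<\alpha<1$. Put $$\bar\theta_T=\frac1T\sum_{t=1}^T\theta_t,\quad \bar A_T=\frac1T\sum_{t=1}^TA_t,\quad \hat\Gamma_T=\frac1T\sum_{t=1}^T(A_t\bar\theta_T-b_t)(A_t\bar\theta_T-b_t)^\top,\quad \hat\Lambda_T=\bar A_T^{-1}\hat\Gamma_T\bar A_T^{-\top},$$ with the convention $\hat\Lambda_T=0$ (so that $\mathcal N(0,\hat\Lambda_T)$ is the point mass at $0$) if $\bar A_T$ is singular. Let $\|\cdot\|$ denote the spectral norm of a matrix and $d_{\mathsf{TV}}$ the total variation distance. There are an absolute constant $C>0$ and, for every such problem (that is, depending on $\mathcal S,\mathcal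 A,P,r,\gamma,\pi,\mu,\phi,\eta_0,\alpha,\theta_0$), a deterministic sequence $\rho_T=o(T^{-1/3})$ as $T\to\infty$, such that for every $T\ge1$ $$d_{\mathsf{TV}}\big(\mathcal N(0,\hat\Lambda_T),\mathcal N(0,\Lambda^\star)\big)\le C\,\frac{\sqrt{\mathsf{Tr}(\Gamma)}}{\lambda_0(1-\gamma)}\,(\|\theta^\star\|_2+1)\,\|\Gamma^{-1}\|\,T^{-1/3}+\rho_T$$ holds with probability at least $1-3T^{-1/3}-\dfrac{\sqrt{\mathsf{Tr}(\Gamma)}}{\lambda_0(1-\gamma)\sqrt T}$. -/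

import Mathlib

open MeasureTheory ProbabilityTheory Matrix Filter Asymptotics

noncomputable section

/-- A discounted Markov decision process with state space `S` and action space `A`, rewards in
`[0,1]` and discount factor in `[0,1)`. -/
structure MDP (S A : Type*) where
  /-- `transition s a` is the law of the next state after action `a` in state `s`. -/
  transition : S → A → PMF S
  reward : S → A → ℝ
  reward_nonneg : ∀ s a, 0 ≤ reward s a
  reward_le_one : ∀ s a, reward s a ≤ 1
  discount : ℝ
  discount_nonneg : 0 ≤ discount
  discount_lt_one : discount < 1

/-- The state transition kernel induced by a policy: choose `a` from `policy s`, then move. -/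
def MDP.inducedKernel {S A : Type*} (M : MDP S A) (policy : S → PMF A) (s : S) : PMF S :=
  (policy s).bind fun a => M.transition s a

/-- The Euclidean norm of a vector. -/
def euclNorm {d : ℕ} (v : Fin d → ℝ) : ℝ := ‖(WithLp.toLp 2 v : EuclideanSpace ℝ (Fin d))‖

/-- The spectral norm of a matrix, i.e. the operator norm for the Euclidean norm. -/
def spectralNorm₂ {d : ℕ} (M : Matrix (Fin d) (Fin d) ℝ) : ℝ :=
  ‖Matrix.toEuclideanCLM (n := Fin d) (𝕜 := ℝ) M‖

/-- The total variation distance of two probability measures: the largest difference of the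
probabilities that they give to a measurable set. -/
def tvDist {E : Type*} [MeasurableSpace E] (P Q : Measure E) : ℝ :=
  ⨆ B : {B : Set E // MeasurableSet B}, |P.real B.1 - Q.real B.1|

/-- The centered Gaussian law on `ℝ^d` with a given covariance matrix. -/
def centeredGaussian {d : ℕ} (L : Matrix (Fin d) (Fin d) ℝ) :
    Measure (EuclideanSpace ℝ (Fin d)) :=
  multivariateGaussian 0 L

/-- The data of a policy evaluation problem with linear function approximation: a Markov decision
process, a policy, the unique stationary law of the induced state chain, and a feature map into
the Euclidean unit ball of `ℝ^d`. -/
structure TDProblem (S A : Type*) (d : ℕ) extends MDP S A where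
  policy : S → PMF A
  stationary : PMF S
  isStationary : stationary.bind (toMDP.inducedKernel policy) = stationary
  stationary_unique : ∀ ν : PMF S, ν.bind (toMDP.inducedKernel policy) = ν → ν = stationary
  feature : S → Fin d → ℝ
  feature_norm_le : ∀ s, euclNorm (feature s) ≤ 1

namespace TDProblem

variable {S A : Type*} {d : ℕ}

/-- The law of a pair `(s, s')` with `s` stationary and `s'` drawn from the induced kernel. -/
def pairLaw (M : TDProblem S A d) : PMF (S × S) :=
  M.stationary.bind fun s => (M.inducedKernel M.policy s).map fun s' => (s, s')

/-- The law of one observation `(s, a, s')`: `s` stationary, `a` drawn from the policy at `s`,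
`s'` drawn from the transition probability at `(s, a)`. -/
def sampleLaw (M : TDProblem S A d) : PMF (S × A × S) :=
  M.stationary.bind fun s => (M.policy s).bind fun a =>
    (M.transition s a).map fun s' => (s, a, s')

/-- `φ(s) (φ(s) - γ φ(s'))ᵀ`. -/
def tdMatrix (M : TDProblem S A d) (s s' : S) : Matrix (Fin d) (Fin d) ℝ :=
  vecMulVec (M.feature s) (M.feature s - M.discount • M.feature s')

/-- The matrix `A_t` of an observation. -/
def sampleA (M : TDProblem S A d) (x : S × A × S) : Matrix (Fin d) (Fin d) ℝ :=
  M.tdMatrix x.1 x.2.2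

/-- The vector `b_t` of an observation, with `r_t = r(s_t, a_t)`. -/
def sampleB (M : TDProblem S A d) (x : S × A × S) : Fin d → ℝ :=
  M.reward x.1 x.2.1 • M.feature x.1

section Population

variable [MeasurableSpace S]

/-- The feature covariance matrix `Σ = E [φ(s) φ(s)ᵀ]`. -/
def featureCov (M : TDProblem S A d) : Matrix (Fin d) (Fin d) ℝ :=
  Matrix.of fun i j => ∫ s, M.feature s i * M.feature s j ∂M.stationary.toMeasure

theorem featureCov_isHermitian (M : TDProblem S A d) : M.featureCov.IsHermitian := by
  ext i j
  simp [featureCov, Matrix.conjTranspose_apply, mul_comm]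

/-- `λ₀`, the smallest eigenvalue of the feature covariance matrix. -/
def lambdaZero (M : TDProblem S A d) : ℝ := ⨅ i, M.featureCov_isHermitian.eigenvalues i

variable [MeasurableSpace A]

/-- The reward function of the policy, `r(s) = E_{a ∼ π(s)} r(s, a)`. -/
def policyReward (M : TDProblem S A d) (s : S) : ℝ :=
  ∫ a, M.reward s a ∂(M.policy s).toMeasure

/-- `A = E [φ(s) (φ(s) - γ φ(s'))ᵀ]`. -/
def meanA (M : TDProblem S A d) : Matrix (Fin d) (Fin d) ℝ :=
  Matrix.of fun i j => ∫ p, M.tdMatrix p.1 p.2 i j ∂M.pairLaw.toMeasure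

/-- `b = E [r(s) φ(s)]`. -/
def meanB (M : TDProblem S A d) : Fin d → ℝ :=
  fun i => ∫ s, M.policyReward s * M.feature s i ∂M.stationary.toMeasure

/-- `θ* = A⁻¹ b`. -/
def thetaStar (M : TDProblem S A d) : Fin d → ℝ := M.meanA⁻¹ *ᵥ M.meanB

/-- `A_t θ* - b_t` for an observation. -/
def noise (M : TDProblem S A d) (x : S × A × S) : Fin d → ℝ :=
  M.sampleA x *ᵥ M.thetaStar - M.sampleB x

/-- `Γ = E [(A_t θ* - b_t) (A_t θ* - b_t)ᵀ]`. -/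
def noiseCov (M : TDProblem S A d) : Matrix (Fin d) (Fin d) ℝ :=
  Matrix.of fun i j => ∫ x, M.noise x i * M.noise x j ∂M.sampleLaw.toMeasure

/-- The asymptotic covariance matrix `Λ* = A⁻¹ Γ A⁻ᵀ`. -/
def asympCov (M : TDProblem S A d) : Matrix (Fin d) (Fin d) ℝ :=
  M.meanA⁻¹ * M.noiseCov * M.meanA⁻¹ᵀ

end Population

/-! In the empirical quantities below, the term `x t` of the sequence `x` is the observation
number `t + 1`; the first `T` observations are `x 0, …, x (T - 1)`. -/

/-- The iterates `θ_t` of temporal difference learning with step sizes `η_t = η₀ t^(-α)`: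
`θ_t = θ_{t-1} - η_t (A_t θ_{t-1} - b_t)`. -/
def iterate (M : TDProblem S A d) (η₀ α : ℝ) (θ₀ : Fin d → ℝ) (x : ℕ → S × A × S) :
    ℕ → Fin d → ℝ
  | 0 => θ₀
  | t + 1 => iterate M η₀ α θ₀ x t - (η₀ * ((t + 1 : ℕ) : ℝ) ^ (-α)) •
      (M.sampleA (x t) *ᵥ iterate M η₀ α θ₀ x t - M.sampleB (x t))

/-- The Polyak-Ruppert average `(θ_1 + … + θ_T) / T`. -/
def avgIterate (M : TDProblem S A d) (η₀ α : ℝ) (θ₀ : Fin d → ℝ) (x : ℕ → S × A × S) (T : ℕ) :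
    Fin d → ℝ :=
  (T : ℝ)⁻¹ • ∑ t ∈ Finset.Icc 1 T, M.iterate η₀ α θ₀ x t

/-- The empirical mean of the matrices `A_1, …, A_T`. -/
def avgA (M : TDProblem S A d) (x : ℕ → S × A × S) (T : ℕ) : Matrix (Fin d) (Fin d) ℝ :=
  (T : ℝ)⁻¹ • ∑ t ∈ Finset.range T, M.sampleA (x t)

/-- The residual `A_t θ̄_T - b_t` of an observation at the averaged iterate. -/
def residual (M : TDProblem S A d) (η₀ α : ℝ) (θ₀ : Fin d → ℝ) (x : ℕ → S × A × S) (T t : ℕ) :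
    Fin d → ℝ :=
  M.sampleA (x t) *ᵥ M.avgIterate η₀ α θ₀ x T - M.sampleB (x t)

/-- The estimator of `Γ`: the average of `(A_t θ̄_T - b_t) (A_t θ̄_T - b_t)ᵀ`. -/
def estNoiseCov (M : TDProblem S A d) (η₀ α : ℝ) (θ₀ : Fin d → ℝ) (x : ℕ → S × A × S) (T : ℕ) :
    Matrix (Fin d) (Fin d) ℝ :=
  (T : ℝ)⁻¹ • ∑ t ∈ Finset.range T,
    vecMulVec (M.residual η₀ α θ₀ x T t) (M.residual η₀ α θ₀ x T t)

/-- The plug-in estimator `Ā_T⁻¹ Γ̂_T Ā_T⁻ᵀ` of the asymptotic covariance. If `Ā_T` is singular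
it is the zero matrix; the Gaussian law is then a point mass, whose total variation distance to
any nondegenerate Gaussian law is the maximal value `1`. -/
def estAsympCov (M : TDProblem S A d) (η₀ α : ℝ) (θ₀ : Fin d → ℝ) (x : ℕ → S × A × S) (T : ℕ) :
    Matrix (Fin d) (Fin d) ℝ :=
  (M.avgA x T)⁻¹ * M.estNoiseCov η₀ α θ₀ x T * (M.avgA x T)⁻¹ᵀ

end TDProblem

end

/-! ### Total variation distance and the Hellinger affinity. -/

section TotalVariation

variable {E F : Type*} [MeasurableSpace E] [MeasurableSpace F]

/-! Both laws are Gaussian, so no central limit theorem is needed: the total variation distance is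
controlled by how far the plug-in covariance is from `Λ*`, and it remains to show that the empirical
quantities concentrate at rate `T^(-1/3)`.

Gaussian part. After a linear change of variables two centered Gaussians become a diagonal one and
the standard one; their Hellinger affinity is a product of explicit one-dimensional integrals, which
bounds the distance by the Frobenius norm of the relative covariance minus the identity
(`tvDist_centeredGaussian_le`). Inserting the law with covariance `B⁻¹ Γ B⁻ᵀ` between the two
sandwich covariances separates the error of `Γ̂` from that of `B = Ā_T`. Both are measured after
conjugation by `Γ^(1/2)`, and a singular `B` makes the bound trivial (`tvDist_plugin_le`).

Probabilistic part. Stationarity gives `vᵀ A v ≥ (1 - γ) λ₀ ‖v‖²`, so the iterates form a linear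
stochastic approximation scheme with coercive mean (`TDProblem.isLinearSA`). The mean square error
of the last iterate is `O(t^(-α))` (`exists_rate`). Summation by parts writes `A` applied to the
summed errors as boundary and step-variation terms minus a martingale. All of it is of smaller order
except the martingale of the noise at `θ*`, so the average has mean square error at most `5 Tr Γ /
(κ² T)` for large `T`, where `κ = (1 - γ) λ₀` (`IsLinearSA.eventually_integral_norm_sq_avg_le`). The
empirical means of `A_t` and of the noise outer products have variances of order `1/T`. Chebyshev's
inequality at level `T^(-1/3)` costs probability `T^(-1/3)` for each of these three quantities.

The bound thus holds from some problem-dependent `T₀` on. Below `T₀` the remainder `ρ_T = 1` makes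
it trivial, and above it `ρ_T = 0`. -/

theorem tvDist_bddAbove (P Q : Measure E) [IsProbabilityMeasure P] [IsProbabilityMeasure Q] :
    BddAbove (Set.range fun B : {B : Set E // MeasurableSet B} => |P.real B.1 - Q.real B.1|) := by
  refine ⟨1, ?_⟩
  rintro _ ⟨B, rfl⟩
  have h1 : P.real B.1 ≤ 1 := measureReal_le_one
  have h2 : Q.real B.1 ≤ 1 := measureReal_le_one
  have h3 : 0 ≤ P.real B.1 := measureReal_nonneg
  have h4 : 0 ≤ Q.real B.1 := measureReal_nonneg
  exact abs_le.2 ⟨by linarith, by linarith⟩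

theorem abs_sub_le_tvDist (P Q : Measure E) [IsProbabilityMeasure P] [IsProbabilityMeasure Q]
    {B : Set E} (hB : MeasurableSet B) : |P.real B - Q.real B| ≤ tvDist P Q :=
  le_ciSup (tvDist_bddAbove P Q) ⟨B, hB⟩

theorem tvDist_le {P Q : Measure E} {c : ℝ}
    (h : ∀ B, MeasurableSet B → |P.real B - Q.real B| ≤ c) : tvDist P Q ≤ c := by
  have : Nonempty {B : Set E // MeasurableSet B} := ⟨⟨∅, MeasurableSet.empty⟩⟩
  exact ciSup_le fun B => h B.1 B.2

theorem tvDist_le_one (P Q : Measure E) [IsProbabilityMeasure P] [IsProbabilityMeasure Q] :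
    tvDist P Q ≤ 1 := by
  refine tvDist_le fun B _ => ?_
  have h1 : P.real B ≤ 1 := measureReal_le_one
  have h2 : Q.real B ≤ 1 := measureReal_le_one
  have h3 : 0 ≤ P.real B := measureReal_nonneg
  have h4 : 0 ≤ Q.real B := measureReal_nonneg
  exact abs_le.2 ⟨by linarith, by linarith⟩

theorem tvDist_triangle (P Q R : Measure E) [IsProbabilityMeasure P] [IsProbabilityMeasure Q]
    [IsProbabilityMeasure R] : tvDist P R ≤ tvDist P Q + tvDist Q R := by
  refine tvDist_le fun B hB => ?_
  have := abs_sub_le (P.real B) (Q.real B) (R.real B)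
  have h1 := abs_sub_le_tvDist P Q hB
  have h2 := abs_sub_le_tvDist Q R hB
  linarith

theorem tvDist_map_le (P Q : Measure E) [IsProbabilityMeasure P] [IsProbabilityMeasure Q]
    {f : E → F} (hf : Measurable f) : tvDist (P.map f) (Q.map f) ≤ tvDist P Q := by
  refine tvDist_le fun B hB => ?_
  rw [map_measureReal_apply hf hB, map_measureReal_apply hf hB]
  exact abs_sub_le_tvDist P Q (hf hB)

/-- A total variation bound through the Hellinger affinity `∫ √p √q`. -/
theorem abs_setIntegral_sub_le_of_affinity {ν : Measure E} {p q : E → ℝ}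
    (hp : ∀ x, 0 ≤ p x) (hq : ∀ x, 0 ≤ q x) (hpi : Integrable p ν) (hqi : Integrable q ν)
    (hp1 : ∫ x, p x ∂ν = 1) (hq1 : ∫ x, q x ∂ν = 1) {r : ℝ} (hr : 0 < r)
    (hr2 : 1 - ∫ x, √(p x) * √(q x) ∂ν ≤ r ^ 2) (B : Set E) :
    |∫ x in B, p x ∂ν - ∫ x in B, q x ∂ν| ≤ 3 * r := by
  have hpq : Integrable (fun x => √(p x) * √(q x)) ν := by
    refine Integrable.mono' (g := fun x => p x + q x) (hpi.add hqi) ?_ (ae_of_all _ fun x => ?_)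
    · exact (Real.continuous_sqrt.comp_aestronglyMeasurable hpi.1).mul
        (Real.continuous_sqrt.comp_aestronglyMeasurable hqi.1)
    · rw [Real.norm_of_nonneg (by positivity)]
      nlinarith [Real.sq_sqrt (hp x), Real.sq_sqrt (hq x), sq_nonneg (√(p x) - √(q x)),
        Real.sqrt_nonneg (p x), Real.sqrt_nonneg (q x)]
  -- Weighted AM-GM on `|p - q| = |√p - √q| |√p + √q|`. The weight `r` makes the first part
  -- integrate to at most `r` and the second to at most `2r`.
  have hbound : ∀ x, |p x - q x| ≤ (1 / (2 * r)) * (p x + q x - 2 * (√(p x) * √(q x)))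
      + (r / 2) * (p x + q x + 2 * (√(p x) * √(q x))) := by
    intro x
    set a := √(p x)
    set b := √(q x)
    have ha : p x = a ^ 2 := (Real.sq_sqrt (hp x)).symm
    have hb : q x = b ^ 2 := (Real.sq_sqrt (hq x)).symm
    have key : 0 ≤ (|a - b| - r * |a + b|) ^ 2 := sq_nonneg _
    have h1 : |p x - q x| = |a - b| * |a + b| := by rw [ha, hb, ← abs_mul]; congr 1; ring
    rw [h1, ha, hb]
    have h2 : |a - b| ^ 2 = a ^ 2 + b ^ 2 - 2 * (a * b) := by rw [sq_abs]; ring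
    have h3 : |a + b| ^ 2 = a ^ 2 + b ^ 2 + 2 * (a * b) := by rw [sq_abs]; ring
    rw [← h2, ← h3]
    rw [← sub_nonneg]
    have : 1 / (2 * r) * |a - b| ^ 2 + r / 2 * |a + b| ^ 2 - |a - b| * |a + b|
      = (1 / (2 * r)) * (|a - b| - r * |a + b|) ^ 2 := by field_simp; ring
    rw [this]; positivity
  have hI1 : Integrable (fun x => p x + q x - 2 * (√(p x) * √(q x))) ν :=
    (hpi.add hqi).sub (hpq.const_mul 2)
  have hI2 : Integrable (fun x => p x + q x + 2 * (√(p x) * √(q x))) ν :=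
    (hpi.add hqi).add (hpq.const_mul 2)
  set c := ∫ x, √(p x) * √(q x) ∂ν with hc
  have e1 : ∫ x, (p x + q x - 2 * (√(p x) * √(q x))) ∂ν = 2 - 2 * c := by
    rw [integral_sub (f := fun x => p x + q x) (hpi.add hqi) (hpq.const_mul 2), integral_add hpi hqi,
      integral_const_mul, hp1, hq1]; ring
  have e2 : ∫ x, (p x + q x + 2 * (√(p x) * √(q x))) ∂ν = 2 + 2 * c := by
    rw [integral_add (f := fun x => p x + q x) (hpi.add hqi) (hpq.const_mul 2), integral_add hpi hqi,
      integral_const_mul, hp1, hq1]; ring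
  have hc1 : c ≤ 1 := by
    have : 0 ≤ ∫ x, (p x + q x - 2 * (√(p x) * √(q x))) ∂ν := integral_nonneg fun x => by
      simp only [Pi.zero_apply]
      nlinarith [Real.sq_sqrt (hp x), Real.sq_sqrt (hq x), sq_nonneg (√(p x) - √(q x))]
    linarith
  calc |∫ x in B, p x ∂ν - ∫ x in B, q x ∂ν| = |∫ x in B, (p x - q x) ∂ν| := by
        rw [integral_sub hpi.integrableOn hqi.integrableOn]
    _ ≤ ∫ x in B, |p x - q x| ∂ν := abs_integral_le_integral_abs
    _ ≤ ∫ x, |p x - q x| ∂ν :=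
        setIntegral_le_integral (hpi.sub hqi).abs (ae_of_all _ fun x => abs_nonneg _)
    _ ≤ ∫ x, ((1 / (2 * r)) * (p x + q x - 2 * (√(p x) * √(q x)))
          + (r / 2) * (p x + q x + 2 * (√(p x) * √(q x)))) ∂ν :=
        integral_mono (hpi.sub hqi).abs ((hI1.const_mul _).add (hI2.const_mul _)) hbound
    _ = (1 / (2 * r)) * (2 - 2 * c) + (r / 2) * (2 + 2 * c) := by
        rw [integral_add (hI1.const_mul _) (hI2.const_mul _), integral_const_mul,
          integral_const_mul, e1, e2]
    _ ≤ 3 * r := by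
        have h1 : (1 / (2 * r)) * (2 - 2 * c) ≤ (1 / (2 * r)) * (2 * r ^ 2) := by
          gcongr; linarith
        have h2 : (1 / (2 * r)) * (2 * r ^ 2) = r := by field_simp
        nlinarith

end TotalVariation

/-! ### Affinity of products of one-dimensional Gaussians. -/

section GaussianAffinity

/-- Turns the affinity of a product, which is a product of affinities, into a sum of coordinate
defects. -/
theorem one_sub_prod_le_sum {ι : Type*} (s : Finset ι) (x : ι → ℝ) (h0 : ∀ i, 0 ≤ x i)
    (h1 : ∀ i, x i ≤ 1) : 1 - ∏ i ∈ s, x i ≤ ∑ i ∈ s, (1 - x i) := by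
  classical
  induction s using Finset.induction_on with
  | empty => simp
  | insert a s ha ih =>
    rw [Finset.prod_insert ha, Finset.sum_insert ha]
    have hp : ∏ i ∈ s, x i ≤ 1 := Finset.prod_le_one (fun i _ => h0 i) fun i _ => h1 i
    nlinarith [h0 a, h1 a]

open scoped NNReal

/-- The geometric mean of two centered Gaussian densities is again a Gaussian kernel, so its
integral is explicit. -/
theorem integral_sqrt_gaussianPDFReal_mul (s : ℝ≥0) (hs : 0 < s) :
    ∫ x, √(gaussianPDFReal 0 (s ^ 2) x) * √(gaussianPDFReal 0 1 x)
      = √(2 * s / (1 + s ^ 2)) := by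
  have hs' : (0 : ℝ) < s := hs
  have h : ∀ x : ℝ, √(gaussianPDFReal 0 (s ^ 2) x) * √(gaussianPDFReal 0 1 x)
      = √((2 * Real.pi * s)⁻¹) * Real.exp (-((1 + (s : ℝ) ^ 2) / (4 * s ^ 2)) * x ^ 2) := by
    intro x
    rw [← Real.sqrt_mul (gaussianPDFReal_nonneg _ _ _), gaussianPDFReal_def, gaussianPDFReal_def]
    simp only [sub_zero, NNReal.coe_pow, NNReal.coe_one, mul_one]
    rw [show √(2 * Real.pi * (s:ℝ) ^ 2) = √(2 * Real.pi) * s by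
      rw [Real.sqrt_mul (by positivity), Real.sqrt_sq hs'.le]]
    rw [show (√(2 * Real.pi) * (s:ℝ))⁻¹ * Real.exp (-x ^ 2 / (2 * (s:ℝ) ^ 2))
        * ((√(2 * Real.pi))⁻¹ * Real.exp (-x ^ 2 / 2))
      = ((2 * Real.pi * s)⁻¹) * (Real.exp (-((1 + (s : ℝ) ^ 2) / (4 * s ^ 2)) * x ^ 2)) ^ 2 by
      rw [← Real.exp_nat_mul, show ((2:ℕ):ℝ) * (-((1 + (s : ℝ) ^ 2) / (4 * s ^ 2)) * x ^ 2)
        = -x ^ 2 / (2 * (s:ℝ) ^ 2) + -x ^ 2 / 2 by push_cast; field_simp; ring, Real.exp_add]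
      have : √(2 * Real.pi) * √(2 * Real.pi) = 2 * Real.pi := Real.mul_self_sqrt (by positivity)
      field_simp
      rw [sq, this]]
    rw [Real.sqrt_mul (by positivity), Real.sqrt_sq (Real.exp_pos _).le]
  simp_rw [h]
  rw [integral_const_mul, integral_gaussian, ← Real.sqrt_mul (by positivity)]
  congr 1
  have := Real.pi_pos
  field_simp
  ring

/-- On `[0, 1]` one has `x ≤ √x`, and `1 - 2s/(1+s²) = (1-s)²/(1+s²)`, which is below
`(1-s)²(1+s)²`. The form in `s²` is what later sums to a Frobenius norm. -/
theorem affinity_defect_le (s : ℝ) (hs : 0 ≤ s) :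
    1 - √(2 * s / (1 + s ^ 2)) ≤ (1 - s ^ 2) ^ 2 := by
  have h0 : 0 ≤ 2 * s / (1 + s ^ 2) := by positivity
  have h1 : 2 * s / (1 + s ^ 2) ≤ 1 := by
    rw [div_le_one (by positivity)]; nlinarith [sq_nonneg (1 - s)]
  have h2 : 2 * s / (1 + s ^ 2) ≤ √(2 * s / (1 + s ^ 2)) := by
    apply Real.le_sqrt_of_sq_le; nlinarith
  have h3 : 1 - 2 * s / (1 + s ^ 2) = (1 - s) ^ 2 / (1 + s ^ 2) := by field_simp; ring
  have h4 : (1 - s) ^ 2 / (1 + s ^ 2) ≤ (1 - s ^ 2) ^ 2 := by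
    rw [div_le_iff₀ (by positivity)]
    nlinarith [mul_nonneg (sq_nonneg (1 - s)) (by positivity : 0 ≤ (2 * s + s ^ 2) * (1 + s ^ 2) + s ^ 2)]
  linarith

variable {d : ℕ}

/-- The product of centered real Gaussian laws has the product density. -/
theorem pi_gaussianReal_measureReal (v : Fin d → ℝ≥0) (hv : ∀ i, v i ≠ 0)
    {B : Set (Fin d → ℝ)} (hB : MeasurableSet B) :
    (Measure.pi fun i => gaussianReal 0 (v i)).real B
      = ∫ x in B, ∏ i, gaussianPDFReal 0 (v i) (x i) := by
  have hm : Measurable fun x : Fin d → ℝ => ∏ i, gaussianPDFReal 0 (v i) (x i) := by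
    refine Finset.measurable_fun_prod _ fun i _ => ?_
    exact (measurable_gaussianPDFReal 0 (v i)).comp (measurable_pi_apply i)
  have hn : ∀ x : Fin d → ℝ, 0 ≤ ∏ i, gaussianPDFReal 0 (v i) (x i) := fun x =>
    Finset.prod_nonneg fun i _ => gaussianPDFReal_nonneg _ _ _
  have hint : Integrable (fun x : Fin d → ℝ => ∏ i, gaussianPDFReal 0 (v i) (x i)) :=
    Integrable.fintype_prod fun i => integrable_gaussianPDFReal 0 (v i)
  have key : (Measure.pi fun i => gaussianReal 0 (v i))
      = volume.withDensity fun x => ENNReal.ofReal (∏ i, gaussianPDFReal 0 (v i) (x i)) := by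
    refine Measure.pi_eq fun s hs => ?_
    rw [withDensity_apply _ (MeasurableSet.univ_pi hs),
      ← ofReal_integral_eq_lintegral_ofReal hint.integrableOn (ae_of_all _ hn)]
    have : ∀ i, gaussianReal 0 (v i) (s i)
        = ENNReal.ofReal (∫ x in s i, gaussianPDFReal 0 (v i) x) := fun i =>
      gaussianReal_apply_eq_integral 0 (hv i) (s i)
    simp_rw [this]
    rw [← ENNReal.ofReal_prod_of_nonneg fun i _ =>
      integral_nonneg fun x => gaussianPDFReal_nonneg _ _ _]
    congr 1
    rw [volume_pi, Measure.restrict_pi_pi]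
    exact integral_fintype_prod_eq_prod (fun i x => gaussianPDFReal 0 (v i) x)
  rw [measureReal_def, key, withDensity_apply _ hB,
    ← ofReal_integral_eq_lintegral_ofReal hint.integrableOn (ae_of_all _ hn),
    ENNReal.toReal_ofReal (integral_nonneg hn)]

/-- Independence makes the affinity multiplicative, so the defect is at most the sum of the
one-dimensional defects. -/
theorem tvDist_pi_gaussianReal_le (s : Fin d → ℝ≥0) {r : ℝ} (hr : 0 < r)
    (h : ∑ i, (1 - (s i : ℝ) ^ 2) ^ 2 ≤ r ^ 2) :
    tvDist (Measure.pi fun i => gaussianReal 0 (s i ^ 2)) (Measure.pi fun _ => gaussianReal 0 1)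
      ≤ 3 * r := by
  by_cases hs : ∀ i, s i ≠ 0
  · refine tvDist_le fun B hB => ?_
    rw [pi_gaussianReal_measureReal _ (fun i => pow_ne_zero 2 (hs i)) hB,
      pi_gaussianReal_measureReal _ (fun i => one_ne_zero) hB]
    have hint : ∀ v : Fin d → ℝ≥0,
        Integrable (fun x : Fin d → ℝ => ∏ i, gaussianPDFReal 0 (v i) (x i)) := fun v =>
      Integrable.fintype_prod fun i => integrable_gaussianPDFReal 0 (v i)
    have hone : ∀ v : Fin d → ℝ≥0, (∀ i, v i ≠ 0) →
        ∫ x : Fin d → ℝ, ∏ i, gaussianPDFReal 0 (v i) (x i) = 1 := by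
      intro v hv
      rw [integral_fintype_prod_volume_eq_prod (fun i x => gaussianPDFReal 0 (v i) x)]
      exact Finset.prod_eq_one fun i _ => integral_gaussianPDFReal_eq_one 0 (hv i)
    refine abs_setIntegral_sub_le_of_affinity
      (fun x => Finset.prod_nonneg fun i _ => gaussianPDFReal_nonneg _ _ _)
      (fun x => Finset.prod_nonneg fun i _ => gaussianPDFReal_nonneg _ _ _)
      (hint _) (hint _) (hone _ fun i => pow_ne_zero 2 (hs i)) (hone _ fun i => one_ne_zero) hr ?_ B
    refine le_trans ?_ h
    have hsq : ∀ x : Fin d → ℝ, √(∏ i, gaussianPDFReal 0 (s i ^ 2) (x i))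
        * √(∏ i, gaussianPDFReal 0 1 (x i))
        = ∏ i, (√(gaussianPDFReal 0 (s i ^ 2) (x i)) * √(gaussianPDFReal 0 1 (x i))) := by
      intro x
      rw [Finset.prod_mul_distrib, Real.sqrt_prod _ fun i _ => gaussianPDFReal_nonneg _ _ _,
        Real.sqrt_prod _ fun i _ => gaussianPDFReal_nonneg _ _ _]
    simp_rw [hsq]
    rw [integral_fintype_prod_volume_eq_prod
      (fun i x => √(gaussianPDFReal 0 (s i ^ 2) x) * √(gaussianPDFReal 0 1 x))]
    simp_rw [fun i => integral_sqrt_gaussianPDFReal_mul (s i) (pos_iff_ne_zero.2 (hs i))]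
    refine (one_sub_prod_le_sum _ _ (fun i => Real.sqrt_nonneg _) fun i => ?_).trans
      (Finset.sum_le_sum fun i _ => affinity_defect_le _ (s i).2)
    rw [Real.sqrt_le_one, div_le_one (by positivity)]
    nlinarith [sq_nonneg (1 - (s i : ℝ))]
  -- A degenerate coordinate has no density, but it alone contributes `1` to the sum; hence `r ≥ 1`
  -- and the bound is trivial.
  · push Not at hs
    obtain ⟨i, hi⟩ := hs
    have h1 : (1 : ℝ) ≤ r ^ 2 := by
      refine le_trans ?_ h
      have := Finset.single_le_sum (f := fun i => (1 - (s i : ℝ) ^ 2) ^ 2)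
        (fun i _ => sq_nonneg _) (Finset.mem_univ i)
      simpa [hi] using this
    have h2 : 1 ≤ r := by nlinarith
    exact (tvDist_le_one _ _).trans (by linarith)

end GaussianAffinity

/-! ### Total variation between multivariate centered Gaussians. -/

section GaussianMatrix

open scoped Matrix.Norms.Frobenius NNReal

variable {d : ℕ}

theorem frobenius_norm_sq_eq_sum {m n : Type*} [Fintype m] [Fintype n] (X : Matrix m n ℝ) :
    ‖X‖ ^ 2 = ∑ i, ∑ j, X i j ^ 2 := by
  rw [frobenius_norm_def, ← Real.sqrt_eq_rpow, Real.sq_sqrt (by positivity)]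
  simp

theorem frobenius_norm_sq_eq_trace {m n : Type*} [Fintype m] [Fintype n] (X : Matrix m n ℝ) :
    ‖X‖ ^ 2 = (X * Xᵀ).trace := by
  rw [frobenius_norm_sq_eq_sum]
  simp [Matrix.trace, Matrix.mul_apply, sq]

theorem charFun_map_stdGaussian (R : Matrix (Fin d) (Fin d) ℝ) (t : EuclideanSpace ℝ (Fin d)) :
    charFun ((stdGaussian (EuclideanSpace ℝ (Fin d))).map (toEuclideanCLM (𝕜 := ℝ) R)) t
      = Complex.exp (-(t.ofLp ⬝ᵥ (R * Rᵀ) *ᵥ t.ofLp : ℝ) / 2) := by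
  have h1 : ∀ x, inner ℝ (toEuclideanCLM (𝕜 := ℝ) R x) t
      = inner ℝ x (toEuclideanCLM (𝕜 := ℝ) Rᵀ t) := by
    intro x
    rw [real_inner_comm, inner_toEuclideanCLM, inner_toEuclideanCLM, mulVec_transpose,
      dotProduct_mulVec, dotProduct_comm]
  rw [charFun_apply, integral_map (by fun_prop) (by fun_prop)]
  simp_rw [h1]
  rw [← charFun_apply, charFun_stdGaussian, ← Complex.ofReal_pow, ← real_inner_self_eq_norm_sq,
    inner_toEuclideanCLM, ofLp_toEuclideanCLM, mulVec_transpose, ← mulVec_mulVec,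
    mulVec_transpose, dotProduct_mulVec]

theorem posSemidef_mul_transpose (R : Matrix (Fin d) (Fin d) ℝ) : (R * Rᵀ).PosSemidef := by
  simpa using posSemidef_self_mul_conjTranspose R

instance centeredGaussian_isProbabilityMeasure (L : Matrix (Fin d) (Fin d) ℝ) :
    IsProbabilityMeasure (centeredGaussian L) := by
  unfold centeredGaussian; infer_instance

/-- The characteristic function sees only `R Rᵀ`, so any factor of the covariance, symmetric or not,
may be used for the pushforward. -/
theorem centeredGaussian_mul_transpose (R : Matrix (Fin d) (Fin d) ℝ) :
    centeredGaussian (R * Rᵀ)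
      = (stdGaussian (EuclideanSpace ℝ (Fin d))).map (toEuclideanCLM (𝕜 := ℝ) R) := by
  have := Measure.isProbabilityMeasure_map (μ := stdGaussian (EuclideanSpace ℝ (Fin d)))
    (f := toEuclideanCLM (𝕜 := ℝ) R) (by fun_prop)
  refine Measure.ext_of_charFun (funext fun t => ?_)
  rw [charFun_map_stdGaussian, centeredGaussian,
    charFun_multivariateGaussian (posSemidef_mul_transpose R)]
  simp [neg_div]

theorem map_diagonal_stdGaussian (s : Fin d → ℝ≥0) :
    (stdGaussian (EuclideanSpace ℝ (Fin d))).map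
        (toEuclideanCLM (𝕜 := ℝ) (diagonal fun i => (s i : ℝ)))
      = (Measure.pi fun i => gaussianReal 0 (s i ^ 2)).map (WithLp.toLp 2) := by
  rw [← map_pi_eq_stdGaussian, Measure.map_map (by fun_prop) (by fun_prop)]
  have h : ⇑(toEuclideanCLM (𝕜 := ℝ) (diagonal fun i => (s i : ℝ))) ∘ WithLp.toLp 2
      = WithLp.toLp 2 ∘ fun (x : Fin d → ℝ) i => (s i : ℝ) * x i := by
    ext x i
    simp [mulVec_diagonal]
  rw [h, ← Measure.map_map (by fun_prop) (by fun_prop), Measure.pi_map_pi (by fun_prop)]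
  congr 2
  ext1 i
  rw [gaussianReal_map_const_mul]
  congr 1
  · simp
  · ext; simp

theorem tvDist_map_diagonal_le (s : Fin d → ℝ≥0) {r : ℝ} (hr : 0 < r)
    (h : ∑ i, (1 - (s i : ℝ) ^ 2) ^ 2 ≤ r ^ 2) :
    tvDist ((stdGaussian (EuclideanSpace ℝ (Fin d))).map
        (toEuclideanCLM (𝕜 := ℝ) (diagonal fun i => (s i : ℝ))))
      (stdGaussian (EuclideanSpace ℝ (Fin d))) ≤ 3 * r := by
  rw [map_diagonal_stdGaussian, ← map_pi_eq_stdGaussian]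
  exact (tvDist_map_le _ _ (by fun_prop)).trans (tvDist_pi_gaussianReal_le s hr h)

/-- The total variation distance of two centered Gaussian laws is bounded by the Frobenius norm
of the relative covariance minus the identity. -/
theorem tvDist_centeredGaussian_le (R S : Matrix (Fin d) (Fin d) ℝ) (hS : IsUnit S.det) :
    tvDist (centeredGaussian (R * Rᵀ)) (centeredGaussian (S * Sᵀ))
      ≤ 3 * ‖S⁻¹ * R * (S⁻¹ * R)ᵀ - 1‖ := by
  set N := S⁻¹ * R with hN
  have hH : (N * Nᵀ).PosSemidef := posSemidef_mul_transpose N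
  set U : Matrix (Fin d) (Fin d) ℝ := hH.1.eigenvectorUnitary.1 with hU
  have hU1 : U * Uᵀ = 1 := by
    simpa [star_eq_conjTranspose] using Unitary.mul_star_self_of_mem hH.1.eigenvectorUnitary.2
  have hU2 : Uᵀ * U = 1 := by
    simpa [star_eq_conjTranspose] using Unitary.star_mul_self_of_mem hH.1.eigenvectorUnitary.2
  set l := hH.1.eigenvalues with hl
  have hl0 : ∀ i, 0 ≤ l i := hH.eigenvalues_nonneg
  have hspec : N * Nᵀ = U * diagonal l * Uᵀ := by
    have := hH.1.spectral_theorem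
    rw [Unitary.conjStarAlgAut_apply] at this
    simpa [star_eq_conjTranspose, Function.comp_def] using this
  set s : Fin d → ℝ≥0 := fun i => Real.toNNReal √(l i) with hs
  have hs2 : ∀ i, (s i : ℝ) ^ 2 = l i := fun i => by
    simp [hs, Real.sq_sqrt (hl0 i), Real.sqrt_nonneg]
  set D : Matrix (Fin d) (Fin d) ℝ := diagonal fun i => (s i : ℝ) with hD
  have hDD : D * Dᵀ = diagonal l := by
    rw [hD, diagonal_transpose, diagonal_mul_diagonal]
    congr 1; ext i; rw [← sq, hs2]
  have hSN : S * N = R := by rw [hN, ← Matrix.mul_assoc, mul_nonsing_inv _ hS, Matrix.one_mul]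
  -- With these factors both laws are images under the same map `S U`, of the diagonal Gaussian and
  -- of the standard one; total variation does not grow under a map.
  have hR : R * Rᵀ = (S * U * D) * (S * U * D)ᵀ := by
    rw [← hSN]
    calc S * N * (S * N)ᵀ = S * (N * Nᵀ) * Sᵀ := by simp only [transpose_mul, Matrix.mul_assoc]
      _ = S * (U * (D * Dᵀ) * Uᵀ) * Sᵀ := by rw [hspec, hDD]
      _ = _ := by simp only [transpose_mul, Matrix.mul_assoc]
  have hSS : S * Sᵀ = (S * U) * (S * U)ᵀ := by
    calc S * Sᵀ = S * (U * Uᵀ) * Sᵀ := by rw [hU1, Matrix.mul_one]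
      _ = _ := by simp only [transpose_mul, Matrix.mul_assoc]
  have hnorm : ∑ i, (1 - (s i : ℝ) ^ 2) ^ 2 = ‖N * Nᵀ - 1‖ ^ 2 := by
    have h1 : N * Nᵀ - 1 = U * (diagonal fun i => l i - 1) * Uᵀ := by
      have : (diagonal fun i => l i - 1) = diagonal l - 1 := by
        rw [← diagonal_one, diagonal_sub]
      rw [this, Matrix.mul_sub, Matrix.sub_mul, Matrix.mul_one, hU1, hspec]
    rw [frobenius_norm_sq_eq_trace, h1]
    have h2 : U * (diagonal fun i => l i - 1) * Uᵀ * (U * (diagonal fun i => l i - 1) * Uᵀ)ᵀ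
        = U * ((diagonal fun i => l i - 1) * (Uᵀ * U) * (diagonal fun i => l i - 1) * Uᵀ) := by
      simp only [transpose_mul, transpose_transpose, diagonal_transpose, Matrix.mul_assoc]
    rw [h2, hU2, Matrix.mul_one, trace_mul_comm, Matrix.mul_assoc, hU2, Matrix.mul_one,
      diagonal_mul_diagonal, trace_diagonal]
    refine Finset.sum_congr rfl fun i _ => ?_
    rw [hs2]; ring
  -- The affinity bound needs a positive radius, so it is used for every `r` above the norm, and `r`
  -- then decreases to it. This covers equal covariances.
  have hdata : ∀ r : ℝ, ‖N * Nᵀ - 1‖ < r →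
      tvDist (centeredGaussian (R * Rᵀ)) (centeredGaussian (S * Sᵀ)) ≤ 3 * r := by
    intro r hr
    have hr0 : 0 < r := (norm_nonneg _).trans_lt hr
    have h1 := tvDist_map_diagonal_le s hr0 (by rw [hnorm]; gcongr)
    rw [hR, hSS, centeredGaussian_mul_transpose, centeredGaussian_mul_transpose]
    have h2 : ⇑(toEuclideanCLM (𝕜 := ℝ) (S * U * D))
        = toEuclideanCLM (𝕜 := ℝ) (S * U) ∘ toEuclideanCLM (𝕜 := ℝ) D := by
      rw [map_mul]; rfl
    rw [h2, ← Measure.map_map (by fun_prop) (by fun_prop)]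
    have := Measure.isProbabilityMeasure_map (μ := stdGaussian (EuclideanSpace ℝ (Fin d)))
      (f := toEuclideanCLM (𝕜 := ℝ) D) (by fun_prop)
    exact (tvDist_map_le _ _ (by fun_prop)).trans h1
  have := le_of_forall_gt_imp_ge_of_dense (a₂ := ‖N * Nᵀ - 1‖)
    (a₁ := tvDist (centeredGaussian (R * Rᵀ)) (centeredGaussian (S * Sᵀ)) / 3)
    fun r hr => by have := hdata r hr; linarith
  linarith

end GaussianMatrix

/-! ### Stability of the sandwich covariance. -/

section PlugIn

open scoped Matrix.Norms.Frobenius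

variable {d : ℕ}

theorem tvDist_comm {E : Type*} [MeasurableSpace E] (P Q : Measure E) :
    tvDist P Q = tvDist Q P := by
  unfold tvDist; simp_rw [abs_sub_comm]

theorem spectralNorm₂_nonneg (X : Matrix (Fin d) (Fin d) ℝ) : 0 ≤ spectralNorm₂ X := norm_nonneg _

theorem norm_toLp_mulVec_le (X : Matrix (Fin d) (Fin d) ℝ) (v : Fin d → ℝ) :
    ‖WithLp.toLp 2 (X *ᵥ v)‖ ≤ spectralNorm₂ X * ‖WithLp.toLp 2 v‖ :=
  (toEuclideanCLM (𝕜 := ℝ) X).le_opNorm (WithLp.toLp 2 v)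

theorem norm_toLp_sq (v : Fin d → ℝ) : ‖WithLp.toLp 2 v‖ ^ 2 = v ⬝ᵥ v := by
  rw [EuclideanSpace.real_norm_sq_eq]; simp [dotProduct, sq]

/-- The squared Frobenius norm is the sum over columns of squared Euclidean norms, and the operator
norm acts on each column. -/
theorem norm_mul_le_spectralNorm₂_mul (X Y : Matrix (Fin d) (Fin d) ℝ) :
    ‖X * Y‖ ≤ spectralNorm₂ X * ‖Y‖ := by
  refine le_of_sq_le_sq ?_ (mul_nonneg (spectralNorm₂_nonneg X) (norm_nonneg _))
  rw [mul_pow, frobenius_norm_sq_eq_sum, frobenius_norm_sq_eq_sum, Finset.sum_comm,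
    Finset.sum_comm (γ := Fin d) (f := fun i j => Y i j ^ 2), Finset.mul_sum]
  refine Finset.sum_le_sum fun j _ => ?_
  have h := norm_toLp_mulVec_le X fun i => Y i j
  have h2 := pow_le_pow_left₀ (norm_nonneg _) h 2
  rw [mul_pow, EuclideanSpace.real_norm_sq_eq, EuclideanSpace.real_norm_sq_eq] at h2
  exact h2

/-- For `w = A⁻¹ x`, coercivity gives `κ‖w‖² ≤ ⟨w, x⟩ ≤ ‖w‖‖x‖`. No symmetry of `A` is involved. -/
theorem spectralNorm₂_inv_le {A : Matrix (Fin d) (Fin d) ℝ} {κ : ℝ} (hκ : 0 < κ)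
    (hA : ∀ v, κ * (v ⬝ᵥ v) ≤ v ⬝ᵥ A *ᵥ v) (hdet : IsUnit A.det) : spectralNorm₂ A⁻¹ ≤ 1 / κ := by
  refine ContinuousLinearMap.opNorm_le_bound _ (by positivity) fun x => ?_
  set w : Fin d → ℝ := A⁻¹ *ᵥ x.ofLp with hw
  have hx : A *ᵥ w = x.ofLp := by rw [hw, mulVec_mulVec, mul_nonsing_inv _ hdet, one_mulVec]
  change ‖WithLp.toLp 2 w‖ ≤ _
  have h1 := hA w
  have h2 : w ⬝ᵥ A *ᵥ w ≤ ‖WithLp.toLp 2 w‖ * ‖x‖ := by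
    rw [hx]
    have := real_inner_le_norm x (WithLp.toLp 2 w)
    rw [mul_comm ‖x‖] at this
    simpa [PiLp.inner_apply, dotProduct] using this
  rw [← norm_toLp_sq] at h1
  rcases eq_or_lt_of_le (norm_nonneg (WithLp.toLp 2 w)) with h0 | h0
  · rw [← h0]; positivity
  · rw [one_div, inv_mul_eq_div, le_div_iff₀ hκ]
    nlinarith

theorem isUnit_det_of_coercive {A : Matrix (Fin d) (Fin d) ℝ} {κ : ℝ} (hκ : 0 < κ)
    (hA : ∀ v, κ * (v ⬝ᵥ v) ≤ v ⬝ᵥ A *ᵥ v) : IsUnit A.det := by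
  by_contra h
  obtain ⟨v, hv, hv0⟩ := exists_mulVec_eq_zero_iff.2 (by simpa using h : A.det = 0)
  have := hA v
  rw [hv0, dotProduct_zero] at this
  have h2 : 0 < v ⬝ᵥ v := by
    rw [← norm_toLp_sq]
    have : WithLp.toLp 2 v ≠ 0 := by simpa using hv
    positivity
  nlinarith

/-- The intermediate law has covariance `B⁻¹ W Wᵀ B⁻ᵀ`. Changing `V` into `W` leaves a relative
covariance in which `B` cancels; changing `B` into `A` leaves a multiplicative perturbation of the
identity. -/
theorem tvDist_relative_le {A B W V : Matrix (Fin d) (Fin d) ℝ} (hA : IsUnit A.det)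
    (hB : IsUnit B.det) (hW : IsUnit W.det) :
    tvDist (centeredGaussian (B⁻¹ * (V * Vᵀ) * B⁻¹ᵀ)) (centeredGaussian (A⁻¹ * (W * Wᵀ) * A⁻¹ᵀ))
      ≤ 3 * ‖W⁻¹ * (V * Vᵀ - W * Wᵀ) * W⁻¹ᵀ‖ + 9 * ‖W⁻¹ * ((B - A) * A⁻¹) * W‖ := by
  have e : ∀ X Y : Matrix (Fin d) (Fin d) ℝ, X⁻¹ * (Y * Yᵀ) * X⁻¹ᵀ = (X⁻¹ * Y) * (X⁻¹ * Y)ᵀ := by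
    intro X Y; simp only [transpose_mul, Matrix.mul_assoc]
  have hBi : IsUnit B⁻¹.det := by rw [det_nonsing_inv]; simpa using hB
  have hdet : IsUnit (B⁻¹ * W).det := by rw [det_mul]; exact hBi.mul hW
  have hinv : (B⁻¹ * W)⁻¹ = W⁻¹ * B := by rw [Matrix.mul_inv_rev, nonsing_inv_nonsing_inv _ hB]
  refine (tvDist_triangle _ (centeredGaussian (B⁻¹ * (W * Wᵀ) * B⁻¹ᵀ)) _).trans (add_le_add ?_ ?_)
  · rw [e, e]
    refine (tvDist_centeredGaussian_le _ _ hdet).trans_eq ?_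
    have h1 : (B⁻¹ * W)⁻¹ * (B⁻¹ * V) = W⁻¹ * V := by
      rw [hinv, Matrix.mul_assoc, ← Matrix.mul_assoc B, mul_nonsing_inv _ hB, Matrix.one_mul]
    have h2 : W⁻¹ * (W * Wᵀ) * W⁻¹ᵀ = 1 := by
      rw [← Matrix.mul_assoc, nonsing_inv_mul _ hW, Matrix.one_mul, ← transpose_mul,
        nonsing_inv_mul _ hW, transpose_one]
    rw [h1, Matrix.mul_sub, Matrix.sub_mul, h2]
    simp only [transpose_mul, Matrix.mul_assoc]
  · set Y := W⁻¹ * ((B - A) * A⁻¹) * W with hY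
    -- In this order the relative factor is `W⁻¹ B A⁻¹ W = 1 + Y`, affine in `B`, so no bound on
    -- `B⁻¹` is needed. For `‖Y‖ ≤ 1` the quadratic term is absorbed, and otherwise the bound
    -- exceeds `1`.
    rw [tvDist_comm, e, e]
    by_cases hy : ‖Y‖ ≤ 1
    · refine (tvDist_centeredGaussian_le _ _ hdet).trans ?_
      have h1 : (B⁻¹ * W)⁻¹ * (A⁻¹ * W) = 1 + Y := by
        rw [hinv, hY, Matrix.sub_mul, mul_nonsing_inv _ hA, Matrix.mul_sub, Matrix.sub_mul,
          Matrix.mul_one, nonsing_inv_mul _ hW]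
        simp only [Matrix.mul_assoc]; abel
      have h2 : (1 + Y) * (1 + Y)ᵀ - 1 = Y + Yᵀ + Y * Yᵀ := by
        rw [transpose_add, transpose_one]; noncomm_ring
      rw [h1, h2]
      have h3 : ‖Y + Yᵀ + Y * Yᵀ‖ ≤ ‖Y‖ + ‖Y‖ + ‖Y‖ * ‖Y‖ := by
        refine (norm_add_le _ _).trans (add_le_add ((norm_add_le _ _).trans_eq ?_)
          ((frobenius_norm_mul _ _).trans_eq ?_)) <;> rw [frobenius_norm_transpose]
      nlinarith [norm_nonneg Y]
    · exact (tvDist_le_one _ _).trans (by linarith)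

/-- If the norm were below `1`, the Neumann series would invert `1 + Y = W⁻¹ B A⁻¹ W`, hence `B`. -/
theorem one_le_norm_of_singular {A B W : Matrix (Fin d) (Fin d) ℝ} (hA : IsUnit A.det)
    (hB : ¬ IsUnit B.det) (hW : IsUnit W.det) : 1 ≤ ‖W⁻¹ * ((B - A) * A⁻¹) * W‖ := by
  set Y := W⁻¹ * ((B - A) * A⁻¹) * W with hY
  by_contra h
  have hcomplete : CompleteSpace (Matrix (Fin d) (Fin d) ℝ) := FiniteDimensional.complete ℝ _
  have hu : IsUnit (1 - -Y) := isUnit_one_sub_of_norm_lt_one (by rw [norm_neg]; linarith)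
  have h1 : 1 - -Y = W⁻¹ * (B * A⁻¹) * W := by
    rw [hY, Matrix.sub_mul, mul_nonsing_inv _ hA, Matrix.mul_sub, Matrix.sub_mul,
      Matrix.mul_one, nonsing_inv_mul _ hW]
    abel
  rw [h1, isUnit_iff_isUnit_det, det_mul, det_mul, det_mul] at hu
  exact hB (isUnit_of_mul_isUnit_left (isUnit_of_mul_isUnit_right (isUnit_of_mul_isUnit_left hu)))

/-- The sandwich covariance `B⁻¹ Γ̂ B⁻ᵀ` (zero if `B` is singular) against `A⁻¹ Γ A⁻ᵀ`. -/
theorem tvDist_plugin_le {A B G H : Matrix (Fin d) (Fin d) ℝ} {κ : ℝ} (hκ : 0 < κ)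
    (hA : ∀ v, κ * (v ⬝ᵥ v) ≤ v ⬝ᵥ A *ᵥ v) (hG : G.PosDef) (hH : H.PosSemidef) :
    tvDist (centeredGaussian (B⁻¹ * H * B⁻¹ᵀ)) (centeredGaussian (A⁻¹ * G * A⁻¹ᵀ))
      ≤ 3 * (spectralNorm₂ G⁻¹ * ‖H - G‖)
        + 9 * (√(spectralNorm₂ G⁻¹) * ‖B - A‖ * (√G.trace / κ)) := by
  have hdA := isUnit_det_of_coercive hκ hA
  obtain ⟨W, hWs, hWW⟩ : ∃ W : Matrix (Fin d) (Fin d) ℝ, Wᵀ = W ∧ W * W = G := by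
    open scoped MatrixOrder in
    refine ⟨CFC.sqrt G, ?_, CFC.sqrt_mul_sqrt_self _ hG.posSemidef.nonneg⟩
    simpa [IsSelfAdjoint, star_eq_conjTranspose] using (CFC.sqrt_nonneg G).isSelfAdjoint
  obtain ⟨V, hV⟩ : ∃ V : Matrix (Fin d) (Fin d) ℝ, V * Vᵀ = H := by
    open scoped MatrixOrder in
    refine ⟨CFC.sqrt H, ?_⟩
    have h : (CFC.sqrt H)ᵀ = CFC.sqrt H := by
      simpa [IsSelfAdjoint, star_eq_conjTranspose] using (CFC.sqrt_nonneg H).isSelfAdjoint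
    rw [h, CFC.sqrt_mul_sqrt_self _ hH.nonneg]
  have hWWt : W * Wᵀ = G := by rw [hWs, hWW]
  have hdW : IsUnit W.det := by
    have := hG.det_pos
    rw [← hWW, det_mul] at this
    exact isUnit_iff_ne_zero.2 fun h => by simp [h] at this
  have hWi : W⁻¹ᵀ = W⁻¹ := by rw [transpose_nonsing_inv, hWs]
  -- The symmetric root `W` of `G` carries both constants: `‖W⁻¹‖² = ‖G⁻¹‖` in spectral norm and
  -- `‖W‖² = Tr G` in Frobenius norm.
  have hsp : spectralNorm₂ W⁻¹ ^ 2 = spectralNorm₂ G⁻¹ := by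
    have hsa : IsSelfAdjoint (toEuclideanCLM (n := Fin d) (𝕜 := ℝ) W⁻¹) := by
      have : IsSelfAdjoint W⁻¹ := by
        simpa [IsSelfAdjoint, star_eq_conjTranspose] using hWi
      exact this.map _
    rw [← hWW, Matrix.mul_inv_rev, spectralNorm₂, spectralNorm₂, map_mul, hsa.norm_mul_self]
  have hsq : √(spectralNorm₂ G⁻¹) = spectralNorm₂ W⁻¹ := by
    rw [← hsp, Real.sqrt_sq (spectralNorm₂_nonneg _)]
  have hWn : ‖W‖ = √G.trace := by
    rw [← hWWt, ← frobenius_norm_sq_eq_trace, Real.sqrt_sq (norm_nonneg _)]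
  -- Only left multiplication has been bounded by the spectral norm; transposing handles the right
  -- factor.
  have hfirst : ‖W⁻¹ * (H - G) * W⁻¹ᵀ‖ ≤ spectralNorm₂ G⁻¹ * ‖H - G‖ := by
    rw [← frobenius_norm_transpose, transpose_mul, transpose_transpose, ← hsp, sq, mul_assoc]
    refine (norm_mul_le_spectralNorm₂_mul _ _).trans ?_
    rw [frobenius_norm_transpose]
    exact mul_le_mul_of_nonneg_left (norm_mul_le_spectralNorm₂_mul _ _) (spectralNorm₂_nonneg _)
  have hsecond : ‖W⁻¹ * ((B - A) * A⁻¹) * W‖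
      ≤ √(spectralNorm₂ G⁻¹) * ‖B - A‖ * (√G.trace / κ) := by
    have h1 : W⁻¹ * ((B - A) * A⁻¹) * W = W⁻¹ * ((B - A) * (A⁻¹ * W)) := by
      simp only [Matrix.mul_assoc]
    rw [h1, hsq, ← hWn, mul_assoc]
    refine (norm_mul_le_spectralNorm₂_mul _ _).trans
      (mul_le_mul_of_nonneg_left ?_ (spectralNorm₂_nonneg _))
    refine (frobenius_norm_mul _ _).trans (mul_le_mul_of_nonneg_left ?_ (norm_nonneg _))
    refine (norm_mul_le_spectralNorm₂_mul _ _).trans ?_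
    rw [div_eq_mul_one_div, mul_comm ‖W‖]
    exact mul_le_mul_of_nonneg_right (spectralNorm₂_inv_le hκ hA hdA) (norm_nonneg _)
  by_cases hB : IsUnit B.det
  · have := tvDist_relative_le (V := V) hdA hB hdW
    rw [hV, hWWt] at this
    linarith
  · have h1 := one_le_norm_of_singular hdA hB hdW
    have h2 : 0 ≤ spectralNorm₂ G⁻¹ * ‖H - G‖ :=
      mul_nonneg (spectralNorm₂_nonneg _) (norm_nonneg _)
    exact (tvDist_le_one _ _).trans (by linarith)

/-- Here `1 ≤ ‖1‖ = ‖G⁻¹ G‖` in Frobenius norm, and `‖G‖ ≤ Tr G` for positive `G`. It serves to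
trade `√‖Γ⁻¹‖` for `‖Γ⁻¹‖`, and it shows that `Tr Γ > 0`. -/
theorem one_le_spectralNorm₂_inv_mul_trace {G : Matrix (Fin d) (Fin d) ℝ} (hG : G.PosDef)
    (hd : 0 < d) : 1 ≤ spectralNorm₂ G⁻¹ * G.trace := by
  obtain ⟨W, hWs, hWW⟩ : ∃ W : Matrix (Fin d) (Fin d) ℝ, Wᵀ = W ∧ W * W = G := by
    open scoped MatrixOrder in
    refine ⟨CFC.sqrt G, ?_, CFC.sqrt_mul_sqrt_self _ hG.posSemidef.nonneg⟩
    simpa [IsSelfAdjoint, star_eq_conjTranspose] using (CFC.sqrt_nonneg G).isSelfAdjoint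
  have h1 : ‖G‖ ≤ G.trace := by
    calc ‖G‖ = ‖W * W‖ := by rw [hWW]
      _ ≤ ‖W‖ * ‖W‖ := frobenius_norm_mul _ _
      _ = (W * Wᵀ).trace := by rw [← sq, frobenius_norm_sq_eq_trace]
      _ = G.trace := by rw [hWs, hWW]
  have h2 : 1 ≤ ‖(1 : Matrix (Fin d) (Fin d) ℝ)‖ := by
    have : (1 : ℝ) ≤ ‖(1 : Matrix (Fin d) (Fin d) ℝ)‖ ^ 2 := by
      rw [frobenius_norm_sq_eq_trace, transpose_one, Matrix.mul_one, trace_one, Fintype.card_fin]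
      exact_mod_cast hd
    nlinarith [norm_nonneg (1 : Matrix (Fin d) (Fin d) ℝ)]
  calc 1 ≤ ‖(1 : Matrix (Fin d) (Fin d) ℝ)‖ := h2
    _ = ‖G⁻¹ * G‖ := by rw [nonsing_inv_mul _ (isUnit_iff_ne_zero.2 hG.det_pos.ne')]
    _ ≤ spectralNorm₂ G⁻¹ * ‖G‖ := norm_mul_le_spectralNorm₂_mul _ _
    _ ≤ _ := mul_le_mul_of_nonneg_left h1 (spectralNorm₂_nonneg _)

end PlugIn

/-! ### Martingale orthogonality and Chebyshev's inequality on the infinite product. -/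

section ProductSpace

theorem DependsOn.sum_step {X E : Type*} [AddCommMonoid E] {D : ℕ → (ℕ → X) → X → E} {k : ℕ}
    (hD : ∀ t y, DependsOn (fun x => D t x y) (Finset.range (t + k) : Set ℕ)) (T : ℕ) :
    DependsOn (fun x => ∑ t ∈ Finset.range T, D t x (x (t + k))) (Finset.range (T + k) : Set ℕ) := by
  intro x y h
  refine Finset.sum_congr rfl fun t ht => ?_
  have ht := Finset.mem_range.1 ht
  rw [h (t + k) (by simpa using ht)]
  exact hD t _ fun i hi => h i (by simp at hi ⊢; omega)

variable {X : Type*} [Countable X] [MeasurableSpace X] [DiscreteMeasurableSpace X]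

/-- Functions of finitely many coordinates in a countable discrete space are measurable. -/
theorem DependsOn.measurable_of_discrete {β : Type*} [MeasurableSpace β] [Nonempty β]
    {f : (ℕ → X) → β} {s : Finset ℕ} (hf : DependsOn f (s : Set ℕ)) : Measurable f := by
  obtain ⟨g, hg⟩ := (dependsOn_iff_exists_comp).1 hf
  rw [hg]
  have : Measurable (g : (((s : Set ℕ)) → X) → β) := by
    have : Finite (s : Set ℕ) := s.finite_toSet
    exact measurable_of_countable g
  exact this.comp (by fun_prop)

variable (ν : Measure X) [IsProbabilityMeasure ν]

local notation "Q" => Measure.infinitePi (fun _ : ℕ => ν)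

theorem integrable_of_dependsOn {E : Type*} [NormedAddCommGroup E] [MeasurableSpace E]
    [BorelSpace E] [SecondCountableTopology E] {f : (ℕ → X) → E} {s : Finset ℕ}
    (hf : DependsOn f (s : Set ℕ)) {B : ℝ} (hB : ∀ x, ‖f x‖ ≤ B) : Integrable f Q :=
  Integrable.of_bound hf.measurable_of_discrete.aestronglyMeasurable B (ae_of_all _ hB)

/-- Under a product measure the coordinate `t` may be integrated out of a function of the
earlier coordinates and of the coordinate `t`. -/
theorem integral_infinitePi_step {F : (ℕ → X) → X → ℝ} {t : ℕ}
    (hF : ∀ y, DependsOn (fun x => F x y) (Finset.range t : Set ℕ)) {B : ℝ}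
    (hB : ∀ x y, |F x y| ≤ B) :
    ∫ x, F x (x t) ∂Q = ∫ x, ∫ y, F x y ∂ν ∂Q := by
  have hind : iIndepFun (fun (i : ℕ) (x : ℕ → X) => x i) Q := by
    have := iIndepFun_infinitePi (P := fun _ : ℕ => ν) (X := fun _ x => x) (fun _ => measurable_id)
    exact this
  have hdisj : Disjoint (Finset.range t) {t} := by simp
  have h2 := hind.indepFun_finset _ _ hdisj (fun i => measurable_pi_apply i)
  have h3 : IndepFun (fun (x : ℕ → X) (i : Finset.range t) => x i) (fun x : ℕ → X => x t) Q :=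
    h2.comp (φ := id) (ψ := fun z : ({t} : Finset ℕ) → X => z ⟨t, by simp⟩) measurable_id
      (measurable_pi_apply (⟨t, by simp⟩ : ({t} : Finset ℕ)))
  have hdep : DependsOn F (Finset.range t : Set ℕ) := fun x x' h => funext fun y => hF y h
  obtain ⟨g, hgF⟩ : ∃ g : (Finset.range t → X) → X → ℝ,
      ∀ x, F x = g fun i : Finset.range t => x i := by
    obtain ⟨g, hg⟩ := (dependsOn_iff_exists_comp).1 hdep
    exact ⟨g, fun x => congrFun hg x⟩
  have hpi : Measurable fun (x : ℕ → X) (i : Finset.range t) => x i :=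
    measurable_pi_lambda _ fun i => measurable_pi_apply _
  have hmt : (Q).map (fun x : ℕ → X => x t) = ν := Measure.infinitePi_map_eval _ t
  have hprod := h3.map_prod_eq_prod_map_map hpi.aemeasurable
    (measurable_pi_apply t).aemeasurable
  rw [hmt] at hprod
  have hX : Nonempty X := by
    by_contra h
    rw [not_nonempty_iff] at h
    have := measure_univ (μ := ν)
    rw [Set.univ_eq_empty_iff.2 h] at this
    simp at this
  -- The bound on `F` passes to `g` by extending a finite tuple to a sequence with an arbitrary
  -- value.
  have hgB : ∀ z y, |g z y| ≤ B := by
    intro z y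
    classical
    have := hB (fun i => if h : i ∈ Finset.range t then z ⟨i, h⟩ else hX.some) y
    rw [hgF] at this
    convert this using 3
    ext i
    have := i.2
    simp_all
  set ρ := (Q).map (fun (x : ℕ → X) (i : Finset.range t) => x i) with hρ
  have : IsProbabilityMeasure ρ := Measure.isProbabilityMeasure_map hpi.aemeasurable
  have hmg : Measurable (Function.uncurry g) := measurable_of_countable _
  calc ∫ x, F x (x t) ∂Q
      = ∫ x, Function.uncurry g (fun i : Finset.range t => x i, x t) ∂Q := by
        simp_rw [hgF]; rfl
    _ = ∫ p, Function.uncurry g p ∂(ρ.prod ν) := by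
        rw [← hprod, integral_map (hpi.prodMk (measurable_pi_apply t)).aemeasurable
          hmg.aestronglyMeasurable]
    _ = ∫ z, (∫ y, g z y ∂ν) ∂ρ := integral_prod _ (Integrable.of_bound
        hmg.aestronglyMeasurable B (ae_of_all _ fun p => hgB p.1 p.2))
    _ = ∫ x, ∫ y, F x y ∂ν ∂Q := by
        rw [hρ, integral_map hpi.aemeasurable (measurable_of_countable _).aestronglyMeasurable]
        simp_rw [hgF]

section Martingale

variable {E : Type*} [NormedAddCommGroup E] [InnerProductSpace ℝ E] 

/-- Orthogonality of martingale increments. -/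
theorem integral_norm_sq_sum_increments {D : ℕ → (ℕ → X) → X → E} {k : ℕ}
    (hD : ∀ t y, DependsOn (fun x => D t x y) (Finset.range (t + k) : Set ℕ))
    (hb : ∀ t, ∃ B, ∀ x y, ‖D t x y‖ ≤ B)
    (hmean : ∀ t x w, ∫ y, inner ℝ w (D t x y) ∂ν = 0) (T : ℕ) :
    ∫ x, ‖∑ t ∈ Finset.range T, D t x (x (t + k))‖ ^ 2 ∂Q
      = ∑ t ∈ Finset.range T, ∫ x, ‖D t x (x (t + k))‖ ^ 2 ∂Q := by
  choose B hB using hb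
  induction T with
  | zero => simp
  | succ T ih =>
    rw [Finset.sum_range_succ, ← ih]
    set M : (ℕ → X) → E := fun x => ∑ t ∈ Finset.range T, D t x (x (t + k)) with hM
    have hMd : DependsOn M (Finset.range (T + k) : Set ℕ) := DependsOn.sum_step hD T
    have hMb : ∀ x, ‖M x‖ ≤ ∑ t ∈ Finset.range T, B t := fun x =>
      (norm_sum_le _ _).trans (Finset.sum_le_sum fun t _ => hB t _ _)
    have hDd : DependsOn (fun x => D T x (x (T + k))) (Finset.range (T + k + 1) : Set ℕ) := by
      intro x y h
      simp only
      rw [h (T + k) (by simp)]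
      exact hD T _ fun i hi => h i (by simp at hi ⊢; omega)
    have hMd' : DependsOn M (Finset.range (T + k + 1) : Set ℕ) := fun x y h =>
      hMd fun i hi => h i (by simp at hi ⊢; omega)
    set b := ∑ t ∈ Finset.range T, B t with hbdef
    have i1 : Integrable (fun x => ‖M x‖ ^ 2) Q :=
      integrable_of_dependsOn ν (s := Finset.range (T + k)) (fun x y h => by simp only [hMd h])
        (B := b ^ 2) fun x => by
          rw [Real.norm_of_nonneg (by positivity)]
          exact pow_le_pow_left₀ (norm_nonneg _) (hMb x) 2
    have i2 : Integrable (fun x => ‖D T x (x (T + k))‖ ^ 2) Q :=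
      integrable_of_dependsOn ν (s := Finset.range (T + k + 1))
        (fun x y h => by have := hDd h; simp only at this ⊢; rw [this])
        (B := B T ^ 2) fun x => by
          rw [Real.norm_of_nonneg (by positivity)]
          exact pow_le_pow_left₀ (norm_nonneg _) (hB T _ _) 2
    have hbi : ∀ x y, |inner ℝ (M x) (D T x y)| ≤ b * B T := fun x y =>
      (abs_real_inner_le_norm _ _).trans (mul_le_mul (hMb x) (hB T _ _) (norm_nonneg _)
        ((norm_nonneg _).trans (hMb x)))
    have i3 : Integrable (fun x => inner ℝ (M x) (D T x (x (T + k)))) Q :=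
      integrable_of_dependsOn ν (s := Finset.range (T + k + 1))
        (fun x y h => by have := hDd h; simp only at this ⊢; rw [this, hMd' h])
        (B := b * B T) fun x => hbi x _
    -- The past sum does not see coordinate `T + k`; integrating that coordinate first gives zero by
    -- the weak centering `hmean`, which needs no `E`-valued integral.
    have hcross : ∫ x, inner ℝ (M x) (D T x (x (T + k))) ∂Q = 0 := by
      rw [integral_infinitePi_step ν (F := fun x y => inner ℝ (M x) (D T x y)) (t := T + k)
        (fun y x x' h => by
          have := hD T y h; simp only at this ⊢; rw [this, hMd h]) hbi]
      simp [hmean]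
    have hexp : ∀ x, ‖∑ t ∈ Finset.range (T + 1), D t x (x (t + k))‖ ^ 2
        = ‖M x‖ ^ 2 + 2 * inner ℝ (M x) (D T x (x (T + k))) + ‖D T x (x (T + k))‖ ^ 2 := by
      intro x
      rw [Finset.sum_range_succ, norm_add_sq_real]
    simp_rw [hexp]
    rw [integral_add (f := fun x => ‖M x‖ ^ 2 + 2 * inner ℝ (M x) (D T x (x (T + k))))
      (i1.add (i3.const_mul 2)) i2, integral_add i1 (i3.const_mul 2),
      integral_const_mul, hcross]
    ring

/-- The mean square error of an empirical mean. -/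
theorem integral_sq_avg_sub_le {Z : X → ℝ} {B : ℝ} (hB : ∀ y, |Z y| ≤ B) {T : ℕ} (hT : 1 ≤ T) :
    ∫ x, ((T : ℝ)⁻¹ * ∑ t ∈ Finset.range T, Z (x t) - ∫ y, Z y ∂ν) ^ 2 ∂Q
      ≤ (T : ℝ)⁻¹ * ∫ y, Z y ^ 2 ∂ν := by
  set m := ∫ y, Z y ∂ν with hm
  have hZi : Integrable Z ν := Integrable.of_bound
    (measurable_of_countable _).aestronglyMeasurable B (ae_of_all _ hB)
  have hZi2 : Integrable (fun y => Z y ^ 2) ν := Integrable.of_bound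
    (measurable_of_countable _).aestronglyMeasurable (B ^ 2) (ae_of_all _ fun y => by
      rw [Real.norm_of_nonneg (by positivity), ← sq_abs]
      exact pow_le_pow_left₀ (abs_nonneg _) (hB y) 2)
  have hmB : |m| ≤ B := by
    simpa using norm_integral_le_of_norm_le_const (μ := ν) (f := Z) (ae_of_all _ hB)
  have key := integral_norm_sq_sum_increments ν (E := ℝ) (D := fun _ _ y => Z y - m) (k := 0)
    (fun t y x x' _ => rfl) (fun t => ⟨B + B, fun x y =>
      (norm_sub_le _ _).trans (add_le_add (hB y) hmB)⟩)
    (fun t x w => by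
      simp only [RCLike.inner_apply, conj_trivial]
      rw [integral_mul_const, integral_sub hZi (integrable_const _)]
      simp [hm]) T
  have hsum : ∀ x : ℕ → X, ((T : ℝ)⁻¹ * ∑ t ∈ Finset.range T, Z (x t) - m) ^ 2
      = ((T : ℝ)⁻¹) ^ 2 * ‖∑ t ∈ Finset.range T, (Z (x (t + 0)) - m)‖ ^ 2 := by
    intro x
    have hT' : (T : ℝ) ≠ 0 := by positivity
    rw [Real.norm_eq_abs, sq_abs, ← mul_pow]
    congr 1
    simp only [add_zero, Finset.sum_sub_distrib, Finset.sum_const, Finset.card_range, nsmul_eq_mul]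
    field_simp
  simp_rw [hsum]
  rw [integral_const_mul, key]
  have hterm : ∀ t ∈ Finset.range T, ∫ x, ‖Z (x (t + 0)) - m‖ ^ 2 ∂Q ≤ ∫ y, Z y ^ 2 ∂ν := by
    intro t _
    have h1 : ∫ x, ‖Z (x (t + 0)) - m‖ ^ 2 ∂Q = ∫ y, (Z y - m) ^ 2 ∂ν := by
      have := integral_map (μ := Q) (φ := fun x : ℕ → X => x t)
        (measurable_pi_apply t).aemeasurable
        (f := fun y => (Z y - m) ^ 2) (measurable_of_countable _).aestronglyMeasurable
      rw [Measure.infinitePi_map_eval _ t] at this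
      rw [this]
      simp
    have h2 : ∀ y, (Z y - m) ^ 2 = Z y ^ 2 - (2 * m) * Z y + m ^ 2 := fun y => by ring
    rw [h1]
    simp_rw [h2]
    rw [integral_add (f := fun y => Z y ^ 2 - 2 * m * Z y) (hZi2.sub (hZi.const_mul _))
        (integrable_const _),
      integral_sub hZi2 (hZi.const_mul _), integral_const_mul, ← hm]
    simp
    nlinarith [sq_nonneg m]
  have h5 := Finset.sum_le_sum hterm
  rw [Finset.sum_const, Finset.card_range, nsmul_eq_mul] at h5
  calc _ ≤ ((T : ℝ)⁻¹) ^ 2 * (T * ∫ y, Z y ^ 2 ∂ν) := by gcongr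
    _ = _ := by field_simp

end Martingale

/-- Chebyshev's inequality in the form used for concentration at level `T^(-1/3)`. -/
theorem measureReal_gt_le_of_integral_sq_le {Ω : Type*} [MeasurableSpace Ω] {P : Measure Ω}
    [IsProbabilityMeasure P] {f : Ω → ℝ} (hf : Integrable (fun x => f x ^ 2) P) {σ : ℝ} (hσ : 0 < σ) {T : ℕ} (hT : 1 ≤ T)
    (h : ∫ x, f x ^ 2 ∂P ≤ σ ^ 2 / T) :
    P.real {x | σ * (T : ℝ) ^ (-(1 / 3) : ℝ) < f x} ≤ (T : ℝ) ^ (-(1 / 3) : ℝ) := by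
  have hT0 : (0 : ℝ) < T := by exact_mod_cast hT
  set τ := (T : ℝ) ^ (-(1 / 3) : ℝ) with hτ
  have hτ0 : 0 < τ := Real.rpow_pos_of_pos hT0 _
  have hτ3 : τ ^ 3 = 1 / T := by
    rw [hτ, ← Real.rpow_natCast, ← Real.rpow_mul hT0.le]
    norm_num
    exact Real.rpow_neg_one _
  have hm := mul_meas_ge_le_integral_of_nonneg (μ := P) (f := fun x => f x ^ 2)
    (ae_of_all _ fun x => sq_nonneg (f x)) hf
    ((σ * τ) ^ 2)
  have hsub : {x | σ * τ < f x} ⊆ {x | (σ * τ) ^ 2 ≤ f x ^ 2} := fun x hx =>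
    pow_le_pow_left₀ (by positivity) (le_of_lt (show σ * τ < f x from hx)) 2
  have h1 := measureReal_mono (μ := P) hsub
  have h2 : (σ * τ) ^ 2 * P.real {x | σ * τ < f x} ≤ σ ^ 2 / T :=
    (mul_le_mul_of_nonneg_left h1 (by positivity)).trans (hm.trans h)
  have h3 : σ ^ 2 / T = (σ * τ) ^ 2 * τ := by
    rw [div_eq_mul_one_div, ← hτ3]; ring
  rw [h3] at h2
  exact le_of_mul_le_mul_left h2 (by positivity)

end ProductSpace

/-! ### Deterministic estimates for the step sizes `t^(-α)`. -/

section StepSizes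

open Topology

/-- For `x ≤ 1` and `α < 1` one has `x ≤ x^α`, applied to `x = (t+1)/(t+2)`. The step sizes
therefore vary by a relative amount of at most `1/(t+2)`. -/
theorem stepSize_ratio {α : ℝ} (h1 : α < 1) (t : ℕ) :
    ((t + 1 : ℕ) : ℝ) ^ (-α) * (1 - 1 / ((t : ℝ) + 2)) ≤ ((t + 1 + 1 : ℕ) : ℝ) ^ (-α) := by
  have ht : (0 : ℝ) < t + 1 := by positivity
  have ht2 : (0 : ℝ) < t + 2 := by positivity
  have e1 : 1 - 1 / ((t : ℝ) + 2) = (t + 1) / (t + 2) := by field_simp; ring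
  have hx : (0 : ℝ) < (t + 1) / (t + 2) := by positivity
  have hx1 : ((t : ℝ) + 1) / (t + 2) ≤ 1 := by rw [div_le_one ht2]; linarith
  have h2 := Real.rpow_le_rpow_of_exponent_ge hx hx1 h1.le
  rw [Real.rpow_one, Real.div_rpow ht.le ht2.le] at h2
  push_cast
  rw [e1, show (t : ℝ) + 1 + 1 = t + 2 by ring, Real.rpow_neg ht.le, Real.rpow_neg ht2.le]
  have h3 : 0 < ((t : ℝ) + 1) ^ α := Real.rpow_pos_of_pos ht _
  calc (((t : ℝ) + 1) ^ α)⁻¹ * ((t + 1) / (t + 2))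
      ≤ (((t : ℝ) + 1) ^ α)⁻¹ * (((t : ℝ) + 1) ^ α / ((t : ℝ) + 2) ^ α) := by gcongr
    _ = _ := by field_simp

theorem tendsto_stepSize {α : ℝ} (h0 : 0 < α) :
    Tendsto (fun t : ℕ => ((t + 1 : ℕ) : ℝ) ^ (-α)) atTop (𝓝 0) :=
  (tendsto_rpow_neg_atTop h0).comp
    (tendsto_natCast_atTop_atTop.comp (tendsto_add_atTop_nat 1))

/-- The decay rate of a contraction perturbed by decreasing step sizes. -/
theorem exists_rate {u : ℕ → ℝ} {η₀ α κ V : ℝ} (hη : 0 < η₀) (h0 : 0 < α) (h1 : α < 1)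
    (hκ : 0 < κ) (hV : 0 ≤ V) (hu : ∀ t, 0 ≤ u t)
    (hrec : ∀ t, u (t + 1) ≤ (1 - 2 * κ * (η₀ * ((t + 1 : ℕ) : ℝ) ^ (-α))
      + 8 * (η₀ * ((t + 1 : ℕ) : ℝ) ^ (-α)) ^ 2) * u t
      + 2 * (η₀ * ((t + 1 : ℕ) : ℝ) ^ (-α)) ^ 2 * V) :
    ∃ K, 0 ≤ K ∧ ∀ t, u t ≤ K * ((t + 1 : ℕ) : ℝ) ^ (-α) := by
  set a : ℕ → ℝ := fun t => ((t + 1 : ℕ) : ℝ) ^ (-α) with ha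
  have hapos : ∀ t, 0 < a t := fun t => Real.rpow_pos_of_pos (by positivity) _
  have hlim := tendsto_stepSize h0
  have hlim2 := tendsto_stepSize (α := 1 - α) (by linarith)
  -- `E1` makes the quadratic term at most half of the drift `κ η₀ a t`, `E2` makes the step-size
  -- loss `1/(t+2)` at most the remaining half (here `α < 1` enters), and `E3` keeps the contraction
  -- factor nonnegative.
  have E1 : ∀ᶠ t in atTop, a t < κ / (16 * η₀) := hlim.eventually_lt_const (by positivity)
  have E2 : ∀ᶠ t : ℕ in atTop, ((t + 1 : ℕ) : ℝ) ^ (-(1 - α)) < κ * η₀ / 2 :=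
    hlim2.eventually_lt_const (by positivity)
  have E3 : ∀ᶠ t in atTop, a t < 1 / (2 * κ * η₀) := hlim.eventually_lt_const (by positivity)
  obtain ⟨t0, ht0⟩ := eventually_atTop.1 (E1.and (E2.and E3))
  have hterm : ∀ s, 0 ≤ u s / a s := fun s => div_nonneg (hu s) (hapos s).le
  -- The first summand lets half of the drift `2 κ η₀ a t` pay for the noise; the sum covers every
  -- `t ≤ t0`.
  set K := 2 * η₀ * V / κ + ∑ s ∈ Finset.range (t0 + 1), u s / a s with hK
  have hS0 : 0 ≤ ∑ s ∈ Finset.range (t0 + 1), u s / a s := Finset.sum_nonneg fun s _ => hterm s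
  have hV0 : 0 ≤ 2 * η₀ * V / κ := by positivity
  have hK0 : 0 ≤ K := by positivity
  have hKV : 2 * η₀ * V ≤ K * κ := by
    rw [← div_le_iff₀ hκ]; linarith
  refine ⟨K, hK0, fun t => ?_⟩
  change u t ≤ K * a t
  have small : ∀ t, t ≤ t0 → u t ≤ K * a t := by
    intro t ht
    rw [← div_le_iff₀ (hapos t)]
    have := Finset.single_le_sum (f := fun s => u s / a s) (fun s _ => hterm s)
      (Finset.mem_range.2 (Nat.lt_succ_of_le ht))
    linarith
  induction t with
  | zero => exact small 0 (Nat.zero_le _)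
  | succ t ih =>
    by_cases ht : t + 1 ≤ t0
    · exact small _ ht
    · obtain ⟨e1, e2, e3⟩ := ht0 t (by omega)
      have hat := hapos t
      have hr := stepSize_ratio h1 t
      change a t * (1 - 1 / ((t : ℝ) + 2)) ≤ a (t + 1) at hr
      have hq : 1 / ((t : ℝ) + 2) ≤ κ * η₀ / 2 * a t := by
        have hpos : (0 : ℝ) < t + 1 := by positivity
        have h3 : 1 / ((t : ℝ) + 1) = ((t + 1 : ℕ) : ℝ) ^ (-(1 - α)) * a t := by
          rw [ha]; simp only
          rw [← Real.rpow_add (by positivity)]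
          push_cast
          rw [show -(1 - α) + -α = -1 by ring, Real.rpow_neg_one, one_div]
        have h4 : 1 / ((t : ℝ) + 2) ≤ 1 / ((t : ℝ) + 1) := by gcongr; norm_num
        rw [h3] at h4
        exact h4.trans (mul_le_mul_of_nonneg_right e2.le hat.le)
      rw [lt_div_iff₀ (by positivity)] at e1 e3
      have hc : 0 ≤ 1 - 2 * κ * (η₀ * a t) + 8 * (η₀ * a t) ^ 2 := by nlinarith [sq_nonneg (η₀ * a t)]
      have hKa : 0 ≤ K * a t := by positivity
      calc u (t + 1) ≤ (1 - 2 * κ * (η₀ * a t) + 8 * (η₀ * a t) ^ 2) * u t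
              + 2 * (η₀ * a t) ^ 2 * V := hrec t
        _ ≤ (1 - 2 * κ * (η₀ * a t) + 8 * (η₀ * a t) ^ 2) * (K * a t)
              + (η₀ * a t ^ 2) * (K * κ) := by
            have h5 := mul_le_mul_of_nonneg_left ih hc
            have h6 := mul_le_mul_of_nonneg_left hKV (by positivity : 0 ≤ η₀ * a t ^ 2)
            nlinarith
        _ = K * a t * (1 - κ * η₀ * a t + (η₀ * a t) * (8 * η₀ * a t)) := by ring
        _ ≤ K * a t * (1 - κ * η₀ * a t + (η₀ * a t) * (κ / 2)) := by
            gcongr; linarith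
        _ = K * (a t * (1 - κ * η₀ / 2 * a t)) := by ring
        _ ≤ K * (a t * (1 - 1 / ((t : ℝ) + 2))) := by gcongr
        _ ≤ K * a (t + 1) := by gcongr

/-- The quantity is of order `T^(α-1) log T`. -/
theorem tendsto_inv_stepSize_mul_log {α : ℝ} (h0 : 0 < α) (h1 : α < 1) :
    Tendsto (fun T : ℕ => (T : ℝ)⁻¹ * ((((T + 1 : ℕ) : ℝ) ^ (-α))⁻¹
      * (1 + ∑ t ∈ Finset.range T, 1 / ((t : ℝ) + 2)))) atTop (𝓝 0) := by
  have hlog : Tendsto (fun T : ℕ => 2 * (2 * (T : ℝ) ^ (-(1 - α))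
      + Real.log T / (T : ℝ) ^ (1 - α))) atTop (𝓝 0) := by
    have e1 := (tendsto_rpow_neg_atTop (y := 1 - α) (by linarith)).comp
      (tendsto_natCast_atTop_atTop (R := ℝ))
    have e2 := ((isLittleO_log_rpow_atTop (r := 1 - α) (by linarith)).tendsto_div_nhds_zero).comp
      (tendsto_natCast_atTop_atTop (R := ℝ))
    simpa [Function.comp_def] using ((e1.const_mul 2).add e2).const_mul 2
  refine tendsto_of_tendsto_of_tendsto_of_le_of_le' tendsto_const_nhds hlog
    (Eventually.of_forall fun T => by positivity) ?_
  filter_upwards [eventually_ge_atTop 1] with T hT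
  have hT0 : (0 : ℝ) < T := by exact_mod_cast hT
  have hT1 : (1 : ℝ) ≤ T := by exact_mod_cast hT
  have hh : ∑ t ∈ Finset.range T, 1 / ((t : ℝ) + 2) ≤ 1 + Real.log T := by
    refine le_trans ?_ (harmonic_le_one_add_log T)
    rw [harmonic]
    push_cast
    refine Finset.sum_le_sum fun t _ => ?_
    rw [one_div]
    gcongr
    norm_num
  have hpow : (((T + 1 : ℕ) : ℝ) ^ (-α))⁻¹ ≤ 2 * (T : ℝ) ^ α := by
    rw [Real.rpow_neg (by positivity), inv_inv]
    push_cast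
    calc ((T : ℝ) + 1) ^ α ≤ (2 * T) ^ α := by
          apply Real.rpow_le_rpow (by positivity) (by linarith) h0.le
      _ = 2 ^ α * (T : ℝ) ^ α := Real.mul_rpow (by norm_num) hT0.le
      _ ≤ 2 ^ (1 : ℝ) * (T : ℝ) ^ α := by
          gcongr
          norm_num
      _ = 2 * (T : ℝ) ^ α := by rw [Real.rpow_one]
  have hl : 0 ≤ Real.log T := Real.log_nonneg hT1
  have e3 : (T : ℝ)⁻¹ * (T : ℝ) ^ α = (T : ℝ) ^ (-(1 - α)) := by
    rw [← Real.rpow_neg_one, ← Real.rpow_add hT0]; congr 1; ring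
  have e4 : Real.log T / (T : ℝ) ^ (1 - α) = (T : ℝ) ^ (-(1 - α)) * Real.log T := by
    rw [Real.rpow_neg hT0.le]; field_simp
  have hs0 : 0 ≤ ∑ t ∈ Finset.range T, 1 / ((t : ℝ) + 2) :=
    Finset.sum_nonneg fun t _ => by positivity
  calc (T : ℝ)⁻¹ * ((((T + 1 : ℕ) : ℝ) ^ (-α))⁻¹ * (1 + ∑ t ∈ Finset.range T, 1 / ((t : ℝ) + 2)))
      ≤ (T : ℝ)⁻¹ * ((2 * (T : ℝ) ^ α) * (1 + (1 + Real.log T))) := by gcongr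
    _ = 2 * ((T : ℝ)⁻¹ * (T : ℝ) ^ α) * (2 + Real.log T) := by ring
    _ = _ := by rw [e3, e4]; ring

end StepSizes

/-! ### Linear stochastic approximation: the recursion and summation by parts. -/

section StochasticApproximation

open Topology

variable {X E : Type*} [NormedAddCommGroup E] [InnerProductSpace ℝ E]

/-- Linear stochastic approximation: the error recursion
`δ_{t+1} = δ_t - η_t (L(x_t) δ_t + e(x_t))`. -/
noncomputable def saError (L : X → E →L[ℝ] E) (e : X → E) (η : ℕ → ℝ) (δ₀ : E) (x : ℕ → X) : ℕ → E
  | 0 => δ₀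
  | t + 1 => saError L e η δ₀ x t - η t • (L (x t) (saError L e η δ₀ x t) + e (x t))

variable {L : X → E →L[ℝ] E} {e : X → E} {η : ℕ → ℝ} {δ₀ : E}

theorem saError_dependsOn (t : ℕ) :
    DependsOn (fun x => saError L e η δ₀ x t) (Finset.range t : Set ℕ) := by
  induction t with
  | zero => intro x y _; rfl
  | succ t ih =>
    intro x y h
    have h1 : saError L e η δ₀ x t = saError L e η δ₀ y t :=
      ih fun i hi => h i (by simp at hi ⊢; omega)
    simp only [saError]
    rw [h1, h t (by simp)]

theorem saError_bounded (hL : ∀ y v, ‖L y v‖ ≤ 2 * ‖v‖) {c : ℝ} (he : ∀ y, ‖e y‖ ≤ c) (t : ℕ) :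
    ∃ B, ∀ x : ℕ → X, ‖saError L e η δ₀ x t‖ ≤ B := by
  induction t with
  | zero => exact ⟨‖δ₀‖, fun x => le_rfl⟩
  | succ t ih =>
    obtain ⟨B, hB⟩ := ih
    refine ⟨B + |η t| * (2 * B + c), fun x => ?_⟩
    simp only [saError]
    refine (norm_sub_le _ _).trans (add_le_add (hB x) ?_)
    rw [norm_smul, Real.norm_eq_abs]
    refine mul_le_mul_of_nonneg_left ((norm_add_le _ _).trans (add_le_add ?_ (he _))) (abs_nonneg _)
    exact (hL _ _).trans (by linarith [hB x])

/-- Summation by parts for the averaged error. -/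
theorem saError_sum_by_parts (A : E →L[ℝ] E) (hη : ∀ t, η t ≠ 0) (x : ℕ → X) (T : ℕ) :
    A (∑ t ∈ Finset.range T, saError L e η δ₀ x (t + 1))
      = ((η 0)⁻¹ • saError L e η δ₀ x 1 - (η T)⁻¹ • saError L e η δ₀ x (T + 1)
          + ∑ t ∈ Finset.range T, ((η (t + 1))⁻¹ - (η t)⁻¹) • saError L e η δ₀ x (t + 1))
        - ∑ t ∈ Finset.range T, (e (x (t + 1)) + (L (x (t + 1)) (saError L e η δ₀ x (t + 1))
            - A (saError L e η δ₀ x (t + 1)))) := by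
  induction T with
  | zero => simp
  | succ T ih =>
    have hstep : saError L e η δ₀ x (T + 1 + 1) = saError L e η δ₀ x (T + 1)
        - η (T + 1) • (L (x (T + 1)) (saError L e η δ₀ x (T + 1)) + e (x (T + 1))) := rfl
    rw [Finset.sum_range_succ, map_add, ih, Finset.sum_range_succ, Finset.sum_range_succ, hstep,
      smul_sub, smul_smul, inv_mul_cancel₀ (hη (T + 1)), one_smul]
    module

end StochasticApproximation

/-! ### Second moments of the error and of its martingale part. -/

section StochasticApproximationMoments

theorem norm_add_sq_le_two {E : Type*} [SeminormedAddCommGroup E] (a b : E) :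
    ‖a + b‖ ^ 2 ≤ 2 * ‖a‖ ^ 2 + 2 * ‖b‖ ^ 2 := by
  have := norm_add_le a b
  nlinarith [norm_nonneg (a + b), norm_nonneg a, norm_nonneg b, sq_nonneg (‖a‖ - ‖b‖)]

open Topology

variable {X : Type*} [Countable X] [MeasurableSpace X] [DiscreteMeasurableSpace X]
  {ν : Measure X} [IsProbabilityMeasure ν]
  {E : Type*} [NormedAddCommGroup E] [InnerProductSpace ℝ E]

local notation "Q" => Measure.infinitePi (fun _ : ℕ => ν)

theorem integrable_of_abs_le {f : X → ℝ} {B : ℝ} (hB : ∀ y, |f y| ≤ B) : Integrable f ν :=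
  Integrable.of_bound (measurable_of_countable _).aestronglyMeasurable B (ae_of_all _ hB)

/-- The assumptions on the observations of a linear stochastic approximation scheme: bounded
operators with coercive mean `A` and bounded centered noise. -/
structure IsLinearSA (ν : Measure X) (L : X → E →L[ℝ] E) (e : X → E) (A : E →L[ℝ] E) (κ c : ℝ) :
    Prop where
  norm_le : ∀ y v, ‖L y v‖ ≤ 2 * ‖v‖
  noise_le : ∀ y, ‖e y‖ ≤ c
  mean : ∀ w v, ∫ y, inner ℝ w (L y v) ∂ν = inner ℝ w (A v)
  noise_mean : ∀ w, ∫ y, inner ℝ w (e y) ∂ν = 0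
  coercive : ∀ v, κ * ‖v‖ ^ 2 ≤ inner ℝ v (A v)

variable {L : X → E →L[ℝ] E} {e : X → E} {A : E →L[ℝ] E} {κ c : ℝ} {η : ℕ → ℝ} {δ₀ : E}

theorem IsLinearSA.integrable_inner_L (h : IsLinearSA ν L e A κ c) (w v : E) :
    Integrable (fun y => inner ℝ w (L y v)) ν :=
  integrable_of_abs_le (B := ‖w‖ * (2 * ‖v‖)) fun y => (abs_real_inner_le_norm _ _).trans
    (mul_le_mul_of_nonneg_left (h.norm_le y v) (norm_nonneg _))

theorem IsLinearSA.integrable_inner_e (h : IsLinearSA ν L e A κ c) (w : E) :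
    Integrable (fun y => inner ℝ w (e y)) ν :=
  integrable_of_abs_le (B := ‖w‖ * c) fun y => (abs_real_inner_le_norm _ _).trans
    (mul_le_mul_of_nonneg_left (h.noise_le y) (norm_nonneg _))

theorem IsLinearSA.integrable_norm_sq_e (h : IsLinearSA ν L e A κ c) :
    Integrable (fun y => ‖e y‖ ^ 2) ν :=
  integrable_of_abs_le (B := c ^ 2) fun y => by
    rw [abs_of_nonneg (by positivity)]
    exact pow_le_pow_left₀ (norm_nonneg _) (h.noise_le y) 2

/-- The weak mean identity tested against `w = A v` passes the pointwise bound on `L` to `A`. -/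
theorem IsLinearSA.norm_A_le (h : IsLinearSA ν L e A κ c) (v : E) : ‖A v‖ ≤ 2 * ‖v‖ := by
  have h1 : ‖A v‖ ^ 2 ≤ ‖A v‖ * (2 * ‖v‖) := by
    rw [← real_inner_self_eq_norm_sq, ← h.mean]
    refine (integral_mono (h.integrable_inner_L _ _) (integrable_const _) fun y =>
      (real_inner_le_norm _ _).trans
        (mul_le_mul_of_nonneg_left (h.norm_le y v) (norm_nonneg _))).trans_eq ?_
    simp
  rcases eq_or_lt_of_le (norm_nonneg (A v)) with h0 | h0
  · rw [← h0]; positivity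
  · nlinarith

theorem IsLinearSA.integrable_norm_sq (h : IsLinearSA ν L e A κ c) (t : ℕ) :
    Integrable (fun x => ‖saError L e η δ₀ x t‖ ^ 2) Q := by
  obtain ⟨B, hB⟩ := saError_bounded (η := η) (δ₀ := δ₀) h.norm_le h.noise_le t
  refine integrable_of_dependsOn ν (s := Finset.range t)
    (fun x y hxy => by have := saError_dependsOn (L := L) (e := e) (η := η) (δ₀ := δ₀) t hxy
                       simp only at this ⊢; rw [this]) (B := B ^ 2) fun x => ?_
  rw [Real.norm_of_nonneg (by positivity)]
  exact pow_le_pow_left₀ (norm_nonneg _) (hB x) 2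

/-- One step of the mean square error recursion. -/
theorem IsLinearSA.integral_norm_sq_succ_le (h : IsLinearSA ν L e A κ c) (hη : ∀ t, 0 ≤ η t)
    (t : ℕ) :
    ∫ x, ‖saError L e η δ₀ x (t + 1)‖ ^ 2 ∂Q
      ≤ (1 - 2 * κ * η t + 8 * η t ^ 2) * ∫ x, ‖saError L e η δ₀ x t‖ ^ 2 ∂Q
        + 2 * η t ^ 2 * ∫ y, ‖e y‖ ^ 2 ∂ν := by
  set V := ∫ y, ‖e y‖ ^ 2 ∂ν with hV
  obtain ⟨B, hB⟩ := saError_bounded (η := η) (δ₀ := δ₀) h.norm_le h.noise_le t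
  set F : (ℕ → X) → X → ℝ := fun x y =>
    ‖saError L e η δ₀ x t - η t • (L y (saError L e η δ₀ x t) + e y)‖ ^ 2 with hF
  have hFdep : ∀ y, DependsOn (fun x => F x y) (Finset.range t : Set ℕ) := by
    intro y x x' hx
    have := saError_dependsOn (L := L) (e := e) (η := η) (δ₀ := δ₀) t hx
    simp only [hF] at this ⊢
    rw [this]
  have hFb : ∀ x y, |F x y| ≤ (B + η t * (2 * B + c)) ^ 2 := by
    intro x y
    rw [abs_of_nonneg (by positivity)]
    refine pow_le_pow_left₀ (norm_nonneg _) ((norm_sub_le _ _).trans (add_le_add (hB x) ?_)) 2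
    rw [norm_smul, Real.norm_of_nonneg (hη t)]
    refine mul_le_mul_of_nonneg_left ((norm_add_le _ _).trans
      (add_le_add ?_ (h.noise_le _))) (hη t)
    exact (h.norm_le _ _).trans (by linarith [hB x])
  have hinner : ∀ x, ∫ y, F x y ∂ν ≤ (1 - 2 * κ * η t + 8 * η t ^ 2) * ‖saError L e η δ₀ x t‖ ^ 2
      + 2 * η t ^ 2 * V := by
    intro x
    set δ := saError L e η δ₀ x t
    have hi1 := h.integrable_inner_L δ δ
    have hi2 := h.integrable_inner_e δ
    have hi12 : Integrable (fun y => inner ℝ δ (L y δ) + inner ℝ δ (e y)) ν := hi1.add hi2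
    have hi3 := h.integrable_norm_sq_e
    -- Expanding the square, the part linear in `η t` averages to minus the coercive drift, and the
    -- rest is bounded by `‖L δ + e‖² ≤ 2(2‖δ‖)² + 2‖e‖²`.
    have hpt : ∀ y, F x y ≤ ((‖δ‖ ^ 2 + 8 * η t ^ 2 * ‖δ‖ ^ 2)
        - (2 * η t) * (inner ℝ δ (L y δ) + inner ℝ δ (e y))) + 2 * η t ^ 2 * ‖e y‖ ^ 2 := by
      intro y
      have h1 : F x y = ‖δ‖ ^ 2 - 2 * (η t * (inner ℝ δ (L y δ) + inner ℝ δ (e y)))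
          + η t ^ 2 * ‖L y δ + e y‖ ^ 2 := by
        simp only [hF]
        rw [norm_sub_sq_real, inner_smul_right, inner_add_right, norm_smul, mul_pow,
          Real.norm_eq_abs, sq_abs]
      have h2 := norm_add_sq_le_two (L y δ) (e y)
      have h3 := pow_le_pow_left₀ (norm_nonneg _) (h.norm_le y δ) 2
      have h4 : η t ^ 2 * ‖L y δ + e y‖ ^ 2 ≤ η t ^ 2 * (8 * ‖δ‖ ^ 2 + 2 * ‖e y‖ ^ 2) := by
        gcongr
        nlinarith
      rw [h1]
      nlinarith
    refine (integral_mono (g := fun y => ((‖δ‖ ^ 2 + 8 * η t ^ 2 * ‖δ‖ ^ 2)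
        - (2 * η t) * (inner ℝ δ (L y δ) + inner ℝ δ (e y))) + 2 * η t ^ 2 * ‖e y‖ ^ 2)
      (integrable_of_abs_le (hFb x)) (((integrable_const _).sub
      (hi12.const_mul _)).add (hi3.const_mul _)) hpt).trans ?_
    rw [integral_add (f := fun y => (‖δ‖ ^ 2 + 8 * η t ^ 2 * ‖δ‖ ^ 2)
        - (2 * η t) * (inner ℝ δ (L y δ) + inner ℝ δ (e y)))
        ((integrable_const _).sub (hi12.const_mul _)) (hi3.const_mul _),
      integral_sub (integrable_const _) (hi12.const_mul _), integral_const_mul,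
      integral_const_mul, integral_add hi1 hi2, h.mean, h.noise_mean, ← hV]
    have := mul_le_mul_of_nonneg_left (h.coercive δ) (hη t)
    simp
    nlinarith
  have hstep : ∫ x, ‖saError L e η δ₀ x (t + 1)‖ ^ 2 ∂Q = ∫ x, ∫ y, F x y ∂ν ∂Q :=
    integral_infinitePi_step ν hFdep hFb
  rw [hstep]
  have hdi : Integrable (fun x => ∫ y, F x y ∂ν) Q :=
    integrable_of_dependsOn ν (s := Finset.range t)
      (fun x x' hx => integral_congr_ae (ae_of_all _ fun y => hFdep y hx))
      (B := (B + η t * (2 * B + c)) ^ 2) fun x => by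
        simpa using norm_integral_le_of_norm_le_const (μ := ν) (f := F x) (ae_of_all _ (hFb x))
  have hni := h.integrable_norm_sq (η := η) (δ₀ := δ₀) t
  refine (integral_mono (g := fun x => (1 - 2 * κ * η t + 8 * η t ^ 2)
    * ‖saError L e η δ₀ x t‖ ^ 2 + 2 * η t ^ 2 * V) hdi ((hni.const_mul _).add (integrable_const _)) hinner).trans_eq ?_
  rw [integral_add (hni.const_mul _) (integrable_const _), integral_const_mul]
  simp

/-- Mean square of the martingale part of the averaged error. -/
theorem IsLinearSA.integral_norm_sq_martingale_le (h : IsLinearSA ν L e A κ c) (T : ℕ) :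
    ∫ x, ‖∑ t ∈ Finset.range T, (e (x (t + 1)) + (L (x (t + 1)) (saError L e η δ₀ x (t + 1))
        - A (saError L e η δ₀ x (t + 1))))‖ ^ 2 ∂Q
      ≤ 2 * T * ∫ y, ‖e y‖ ^ 2 ∂ν
        + 32 * ∑ t ∈ Finset.range T, ∫ x, ‖saError L e η δ₀ x (t + 1)‖ ^ 2 ∂Q := by
  set V := ∫ y, ‖e y‖ ^ 2 ∂ν with hV
  set D : ℕ → (ℕ → X) → X → E := fun t x y =>
    e y + (L y (saError L e η δ₀ x (t + 1)) - A (saError L e η δ₀ x (t + 1))) with hD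
  have hDdep : ∀ t y, DependsOn (fun x => D t x y) (Finset.range (t + 1) : Set ℕ) := by
    intro t y x x' hx
    have := saError_dependsOn (L := L) (e := e) (η := η) (δ₀ := δ₀) (t + 1) hx
    simp only [hD] at this ⊢
    rw [this]
  have hLA : ∀ y v, ‖L y v - A v‖ ≤ 4 * ‖v‖ := fun y v =>
    (norm_sub_le _ _).trans (by linarith [h.norm_le y v, h.norm_A_le v])
  have hDb : ∀ t, ∃ B, ∀ x y, ‖D t x y‖ ≤ B := by
    intro t
    obtain ⟨B, hB⟩ := saError_bounded (η := η) (δ₀ := δ₀) h.norm_le h.noise_le (t + 1)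
    refine ⟨c + 4 * B, fun x y => (norm_add_le _ _).trans (add_le_add (h.noise_le y) ?_)⟩
    exact (hLA _ _).trans (by linarith [hB x])
  have hDm : ∀ t x w, ∫ y, inner ℝ w (D t x y) ∂ν = 0 := by
    intro t x w
    simp only [hD, inner_add_right, inner_sub_right]
    rw [integral_add (g := fun y => inner ℝ w (L y (saError L e η δ₀ x (t + 1)))
        - inner ℝ w (A (saError L e η δ₀ x (t + 1)))) (h.integrable_inner_e w) ((h.integrable_inner_L w _).sub (integrable_const _)),
      integral_sub (h.integrable_inner_L w _) (integrable_const _), h.noise_mean, h.mean]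
    simp
  have key := integral_norm_sq_sum_increments ν hDdep hDb hDm T
  refine key.trans_le ?_
  have hterm : ∀ t ∈ Finset.range T, ∫ x, ‖D t x (x (t + 1))‖ ^ 2 ∂Q
      ≤ 2 * V + 32 * ∫ x, ‖saError L e η δ₀ x (t + 1)‖ ^ 2 ∂Q := by
    intro t _
    have hi := h.integrable_norm_sq (η := η) (δ₀ := δ₀) (t + 1)
    have hmt : (Q).map (fun x : ℕ → X => x (t + 1)) = ν := Measure.infinitePi_map_eval _ (t + 1)
    have hei : Integrable (fun x : ℕ → X => ‖e (x (t + 1))‖ ^ 2) Q := by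
      have h1 := h.integrable_norm_sq_e
      rw [← hmt] at h1
      exact h1.comp_measurable (measurable_pi_apply (t + 1))
    have hev : ∫ x : ℕ → X, ‖e (x (t + 1))‖ ^ 2 ∂Q = V := by
      have := integral_map (μ := Q) (φ := fun x : ℕ → X => x (t + 1))
        (measurable_pi_apply (t + 1)).aemeasurable
        (f := fun y => ‖e y‖ ^ 2) (measurable_of_countable _).aestronglyMeasurable
      rw [hmt] at this
      rw [← this]
    have hDi : Integrable (fun x => ‖D t x (x (t + 1))‖ ^ 2) Q := by
      obtain ⟨B, hB⟩ := hDb t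
      refine integrable_of_dependsOn ν (s := Finset.range (t + 2)) (fun x x' hx => ?_)
        (B := B ^ 2) fun x => ?_
      · have h1 := hDdep t (x (t + 1)) (fun i hi => hx i (by simp at hi ⊢; omega) :
          ∀ i ∈ (Finset.range (t + 1) : Set ℕ), x i = x' i)
        simp only at h1 ⊢
        rw [h1, hx (t + 1) (by simp)]
      · rw [Real.norm_of_nonneg (by positivity)]
        exact pow_le_pow_left₀ (norm_nonneg _) (hB _ _) 2
    calc ∫ x, ‖D t x (x (t + 1))‖ ^ 2 ∂Q
        ≤ ∫ x, (2 * ‖e (x (t + 1))‖ ^ 2 + 32 * ‖saError L e η δ₀ x (t + 1)‖ ^ 2) ∂Q := by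
          refine integral_mono hDi ((hei.const_mul 2).add (hi.const_mul 32)) fun x => ?_
          have h1 := norm_add_sq_le_two (e (x (t + 1)))
            (L (x (t + 1)) (saError L e η δ₀ x (t + 1)) - A (saError L e η δ₀ x (t + 1)))
          have h2 := pow_le_pow_left₀ (norm_nonneg _)
            (hLA (x (t + 1)) (saError L e η δ₀ x (t + 1))) 2
          simp only [hD]
          nlinarith
      _ = _ := by
          rw [integral_add (hei.const_mul 2) (hi.const_mul 32), integral_const_mul,
            integral_const_mul, hev]
  refine (Finset.sum_le_sum hterm).trans_eq ?_
  rw [Finset.sum_add_distrib, ← Finset.mul_sum]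
  simp only [Finset.sum_const, Finset.card_range, nsmul_eq_mul, Finset.mul_sum]
  ring

end StochasticApproximationMoments

/-! ### Mean square error of the averaged iterates. -/

section AveragedError

theorem norm_three_sq_le {E : Type*} [SeminormedAddCommGroup E] (a b d : E) :
    ‖a - b + d‖ ^ 2 ≤ 3 * (‖a‖ ^ 2 + ‖b‖ ^ 2 + ‖d‖ ^ 2) := by
  have h : ‖a - b + d‖ ≤ ‖a‖ + ‖b‖ + ‖d‖ :=
    (norm_add_le _ _).trans (by gcongr; exact norm_sub_le _ _)
  have h2 := pow_le_pow_left₀ (norm_nonneg _) h 2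
  nlinarith [sq_nonneg (‖a‖ - ‖b‖), sq_nonneg (‖a‖ - ‖d‖), sq_nonneg (‖b‖ - ‖d‖)]

open Topology

variable {X : Type*} [Countable X] [MeasurableSpace X] [DiscreteMeasurableSpace X]
  {ν : Measure X} [IsProbabilityMeasure ν]
  {E : Type*} [NormedAddCommGroup E] [InnerProductSpace ℝ E]
  {L : X → E →L[ℝ] E} {e : X → E} {A : E →L[ℝ] E} {κ c : ℝ} {δ₀ : E}

local notation "Q" => Measure.infinitePi (fun _ : ℕ => ν)

theorem norm_sum_smul_sq_le (s : Finset ℕ) (w : ℕ → ℝ) (hw : ∀ t, 0 ≤ w t) (v : ℕ → E) :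
    ‖∑ t ∈ s, w t • v t‖ ^ 2 ≤ (∑ t ∈ s, w t) * ∑ t ∈ s, w t * ‖v t‖ ^ 2 := by
  have h1 : ‖∑ t ∈ s, w t • v t‖ ≤ ∑ t ∈ s, w t * ‖v t‖ :=
    (norm_sum_le _ _).trans_eq (Finset.sum_congr rfl fun t _ => by
      rw [norm_smul, Real.norm_of_nonneg (hw t)])
  refine (pow_le_pow_left₀ (norm_nonneg _) h1 2).trans ?_
  exact Finset.sum_sq_le_sum_mul_sum_of_sq_le_mul s (fun t _ => hw t)
    (fun t _ => mul_nonneg (hw t) (sq_nonneg _)) (fun t _ => le_of_eq (by ring))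

omit [Countable X] [DiscreteMeasurableSpace X] [IsProbabilityMeasure ν] in
/-- The pathwise bound behind the central limit rate of averaged stochastic approximation. -/
theorem IsLinearSA.norm_sq_sum_le (h : IsLinearSA ν L e A κ c) (hκ : 0 ≤ κ) {η : ℕ → ℝ}
    (hη : ∀ t, 0 < η t) (hmono : ∀ t, η (t + 1) ≤ η t) (x : ℕ → X) (T : ℕ) :
    κ ^ 2 * ‖∑ t ∈ Finset.range T, saError L e η δ₀ x (t + 1)‖ ^ 2
      ≤ 6 * (((η 0)⁻¹) ^ 2 * ‖saError L e η δ₀ x 1‖ ^ 2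
          + ((η T)⁻¹) ^ 2 * ‖saError L e η δ₀ x (T + 1)‖ ^ 2
          + (η T)⁻¹ * ∑ t ∈ Finset.range T,
              ((η (t + 1))⁻¹ - (η t)⁻¹) * ‖saError L e η δ₀ x (t + 1)‖ ^ 2)
        + 2 * ‖∑ t ∈ Finset.range T, (e (x (t + 1)) + (L (x (t + 1)) (saError L e η δ₀ x (t + 1))
            - A (saError L e η δ₀ x (t + 1))))‖ ^ 2 := by
  set S := ∑ t ∈ Finset.range T, saError L e η δ₀ x (t + 1) with hS
  have h1 : κ * ‖S‖ ≤ ‖A S‖ := by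
    have h2 := (h.coercive S).trans (real_inner_le_norm S (A S))
    rcases eq_or_lt_of_le (norm_nonneg S) with h0 | h0
    · rw [← h0]; simp
    · nlinarith
  have h3 : κ ^ 2 * ‖S‖ ^ 2 ≤ ‖A S‖ ^ 2 := by
    rw [← mul_pow]; exact pow_le_pow_left₀ (by positivity) h1 2
  refine h3.trans ?_
  rw [hS, saError_sum_by_parts A (fun t => (hη t).ne')]
  have hw : ∀ t, 0 ≤ (η (t + 1))⁻¹ - (η t)⁻¹ := fun t =>
    sub_nonneg.2 (inv_anti₀ (hη _) (hmono t))
  rw [sub_eq_add_neg]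
  refine (norm_add_sq_le_two _ _).trans ?_
  rw [norm_neg]
  refine add_le_add ?_ le_rfl
  refine (mul_le_mul_of_nonneg_left (norm_three_sq_le _ _ _) zero_le_two).trans ?_
  rw [norm_smul, norm_smul, mul_pow, mul_pow, Real.norm_eq_abs, Real.norm_eq_abs, sq_abs, sq_abs]
  -- Cauchy-Schwarz with the weights `1/η_{t+1} - 1/η_t`, which are nonnegative and telescope to at
  -- most `1/η_T`.
  have h5 : ‖∑ t ∈ Finset.range T, ((η (t + 1))⁻¹ - (η t)⁻¹) • saError L e η δ₀ x (t + 1)‖ ^ 2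
      ≤ (η T)⁻¹ * ∑ t ∈ Finset.range T,
          ((η (t + 1))⁻¹ - (η t)⁻¹) * ‖saError L e η δ₀ x (t + 1)‖ ^ 2 := by
    refine (norm_sum_smul_sq_le _ _ hw _).trans ?_
    refine mul_le_mul_of_nonneg_right ?_
      (Finset.sum_nonneg fun t _ => mul_nonneg (hw t) (sq_nonneg _))
    rw [Finset.sum_range_sub (fun t => (η t)⁻¹)]
    have := inv_pos.2 (hη 0)
    linarith
  linarith

/-- The averaged iterates have mean square error of order `V / (κ² T)`, where `V` is the trace of
the noise covariance. -/
theorem IsLinearSA.eventually_integral_norm_sq_avg_le (h : IsLinearSA ν L e A κ c) (hκ : 0 < κ)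
    {η₀ α : ℝ} (hη₀ : 0 < η₀) (hα0 : 0 < α) (hα1 : α < 1) (hV : 0 < ∫ y, ‖e y‖ ^ 2 ∂ν) :
    ∀ᶠ T : ℕ in atTop,
      ∫ x, ‖(T : ℝ)⁻¹ • ∑ t ∈ Finset.range T,
          saError L e (fun t => η₀ * ((t + 1 : ℕ) : ℝ) ^ (-α)) δ₀ x (t + 1)‖ ^ 2 ∂Q
        ≤ 5 * (∫ y, ‖e y‖ ^ 2 ∂ν) / (κ ^ 2 * T) := by
  set V := ∫ y, ‖e y‖ ^ 2 ∂ν with hVdef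
  set a : ℕ → ℝ := fun t => ((t + 1 : ℕ) : ℝ) ^ (-α) with ha
  set η : ℕ → ℝ := fun t => η₀ * a t with hη
  have hapos : ∀ t, 0 < a t := fun t => Real.rpow_pos_of_pos (by positivity) _
  have hηpos : ∀ t, 0 < η t := fun t => mul_pos hη₀ (hapos t)
  have hamono : ∀ t, a (t + 1) ≤ a t := fun t =>
    Real.rpow_le_rpow_of_nonpos (by positivity) (by push_cast; linarith) (by linarith)
  have hηmono : ∀ t, η (t + 1) ≤ η t := fun t => mul_le_mul_of_nonneg_left (hamono t) hη₀.le
  set u : ℕ → ℝ := fun t => ∫ x, ‖saError L e η δ₀ x t‖ ^ 2 ∂Q with hu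
  have hu0 : ∀ t, 0 ≤ u t := fun t => integral_nonneg fun x => sq_nonneg _
  obtain ⟨K, hK0, hK⟩ := exists_rate (u := u) (κ := κ) (V := V) hη₀ hα0 hα1 hκ hV.le hu0
    fun t => h.integral_norm_sq_succ_le (fun t => (hηpos t).le) t
  change ∀ t, u t ≤ K * a t at hK
  have hui : ∀ t, Integrable (fun x => ‖saError L e η δ₀ x t‖ ^ 2) Q :=
    fun t => h.integrable_norm_sq t
  set w : ℕ → ℝ := fun t => (η (t + 1))⁻¹ - (η t)⁻¹ with hw
  have hw0 : ∀ t, 0 ≤ w t := fun t => sub_nonneg.2 (inv_anti₀ (hηpos _) (hηmono t))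
  -- The rate `u = O(a)` cancels the growth of `1/η` and leaves `1 - a (t+1) / a t`, whose sum is
  -- only logarithmic.
  have hwu : ∀ t, w t * u (t + 1) ≤ (K / η₀) * (1 / ((t : ℝ) + 2)) := by
    intro t
    have h1 : w t * u (t + 1) ≤ w t * (K * a (t + 1)) := mul_le_mul_of_nonneg_left (hK _) (hw0 t)
    have h2 : w t * (K * a (t + 1)) = (K / η₀) * (1 - a (t + 1) / a t) := by
      have := (hapos t).ne'
      have := (hapos (t + 1)).ne'
      simp only [hw, hη]
      field_simp
    have h3 : 1 - a (t + 1) / a t ≤ 1 / ((t : ℝ) + 2) := by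
      have := stepSize_ratio hα1 t
      rw [mul_comm, ← le_div_iff₀ (hapos t)] at this
      change 1 - 1 / ((t : ℝ) + 2) ≤ a (t + 1) / a t at this
      linarith
    rw [h2] at h1
    exact h1.trans (mul_le_mul_of_nonneg_left h3 (by positivity))
  set M : ℕ → (ℕ → X) → E := fun T x => ∑ t ∈ Finset.range T,
    (e (x (t + 1)) + (L (x (t + 1)) (saError L e η δ₀ x (t + 1))
      - A (saError L e η δ₀ x (t + 1)))) with hM
  set H : ℕ → ℝ := fun T => ∑ t ∈ Finset.range T, 1 / ((t : ℝ) + 2) with hH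
  have hMi : ∀ T, Integrable (fun x => ‖M T x‖ ^ 2) Q := by
    intro T
    have hb : ∀ t, ∃ B, ∀ x : ℕ → X, ‖e (x (t + 1)) + (L (x (t + 1)) (saError L e η δ₀ x (t + 1))
        - A (saError L e η δ₀ x (t + 1)))‖ ≤ B := by
      intro t
      obtain ⟨B, hB⟩ := saError_bounded (η := η) (δ₀ := δ₀) h.norm_le h.noise_le (t + 1)
      refine ⟨c + (2 * B + 2 * B), fun x => (norm_add_le _ _).trans (add_le_add (h.noise_le _)
        ((norm_sub_le _ _).trans (add_le_add ?_ ?_)))⟩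
      · exact (h.norm_le _ _).trans (by linarith [hB x])
      · exact (h.norm_A_le _).trans (by linarith [hB x])
    choose B hB using hb
    refine integrable_of_dependsOn ν (s := Finset.range (T + 1)) (fun x x' hx => ?_)
      (B := (∑ t ∈ Finset.range T, B t) ^ 2) fun x => ?_
    · have : M T x = M T x' := by
        refine Finset.sum_congr rfl fun t ht => ?_
        have ht := Finset.mem_range.1 ht
        have h1 : saError L e η δ₀ x (t + 1) = saError L e η δ₀ x' (t + 1) :=
          saError_dependsOn (t + 1) fun i hi => hx i (by simp at hi ⊢; omega)
        rw [h1, hx (t + 1) (by simp; omega)]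
      simp only [this]
    · rw [Real.norm_of_nonneg (by positivity)]
      exact pow_le_pow_left₀ (norm_nonneg _)
        ((norm_sum_le _ _).trans (Finset.sum_le_sum fun t _ => hB t x)) 2
  set C := 6 * (((η 0)⁻¹) ^ 2 * u 1) with hC
  have hmain : ∀ T, κ ^ 2 * ∫ x, ‖∑ t ∈ Finset.range T, saError L e η δ₀ x (t + 1)‖ ^ 2 ∂Q
      ≤ C + 6 * (K / η₀ ^ 2) * ((a T)⁻¹ * (1 + H T)) + 4 * V * T
        + 64 * ∑ t ∈ Finset.range T, u (t + 1) := by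
    intro T
    have i1 := (hui 1).const_mul (((η 0)⁻¹) ^ 2)
    have i2 := (hui (T + 1)).const_mul (((η T)⁻¹) ^ 2)
    have i3 : Integrable (fun x => ∑ t ∈ Finset.range T, w t * ‖saError L e η δ₀ x (t + 1)‖ ^ 2) Q :=
      integrable_finsetSum _ fun t _ => (hui (t + 1)).const_mul _
    have i4 := i3.const_mul ((η T)⁻¹)
    have i12 : Integrable (fun x => ((η 0)⁻¹) ^ 2 * ‖saError L e η δ₀ x 1‖ ^ 2
          + ((η T)⁻¹) ^ 2 * ‖saError L e η δ₀ x (T + 1)‖ ^ 2) Q := i1.add i2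
    have i124 : Integrable (fun x => ((η 0)⁻¹) ^ 2 * ‖saError L e η δ₀ x 1‖ ^ 2
          + ((η T)⁻¹) ^ 2 * ‖saError L e η δ₀ x (T + 1)‖ ^ 2
          + (η T)⁻¹ * ∑ t ∈ Finset.range T, w t * ‖saError L e η δ₀ x (t + 1)‖ ^ 2) Q := i12.add i4
    rw [← integral_const_mul]
    calc ∫ x, κ ^ 2 * ‖∑ t ∈ Finset.range T, saError L e η δ₀ x (t + 1)‖ ^ 2 ∂Q
        ≤ ∫ x, (6 * (((η 0)⁻¹) ^ 2 * ‖saError L e η δ₀ x 1‖ ^ 2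
          + ((η T)⁻¹) ^ 2 * ‖saError L e η δ₀ x (T + 1)‖ ^ 2
          + (η T)⁻¹ * ∑ t ∈ Finset.range T, w t * ‖saError L e η δ₀ x (t + 1)‖ ^ 2)
          + 2 * ‖M T x‖ ^ 2) ∂Q :=
          integral_mono_of_nonneg (ae_of_all _ fun x => by positivity)
            ((i124.const_mul 6).add ((hMi T).const_mul 2))
            (ae_of_all _ fun x => h.norm_sq_sum_le hκ.le hηpos hηmono x T)
      _ = 6 * (((η 0)⁻¹) ^ 2 * u 1 + ((η T)⁻¹) ^ 2 * u (T + 1)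
          + (η T)⁻¹ * ∑ t ∈ Finset.range T, w t * u (t + 1)) + 2 * ∫ x, ‖M T x‖ ^ 2 ∂Q := by
          rw [integral_add (i124.const_mul 6) ((hMi T).const_mul 2), integral_const_mul,
            integral_const_mul, integral_add i12 i4, integral_add i1 i2, integral_const_mul,
            integral_const_mul, integral_const_mul,
            integral_finsetSum _ fun t _ => (hui (t + 1)).const_mul _]
          simp_rw [integral_const_mul]
          rfl
      _ ≤ 6 * (((η 0)⁻¹) ^ 2 * u 1 + K / η₀ ^ 2 * (a T)⁻¹
          + (η T)⁻¹ * ∑ t ∈ Finset.range T, (K / η₀) * (1 / ((t : ℝ) + 2)))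
          + 2 * (2 * T * V + 32 * ∑ t ∈ Finset.range T, u (t + 1)) := by
          have h5 : ((η T)⁻¹) ^ 2 * u (T + 1) ≤ K / η₀ ^ 2 * (a T)⁻¹ := by
            calc ((η T)⁻¹) ^ 2 * u (T + 1) ≤ ((η T)⁻¹) ^ 2 * (K * a T) := by
                  gcongr
                  exact (hK _).trans (mul_le_mul_of_nonneg_left (hamono T) hK0)
              _ = _ := by
                  have := (hapos T).ne'
                  simp only [hη]; field_simp
          have h6 := h.integral_norm_sq_martingale_le (η := η) (δ₀ := δ₀) T
          have h7 : 0 < (η T)⁻¹ := inv_pos.2 (hηpos T)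
          have h8 := mul_le_mul_of_nonneg_left
            (Finset.sum_le_sum fun t (_ : t ∈ Finset.range T) => hwu t) h7.le
          linarith
      _ = _ := by
          rw [← Finset.mul_sum, hC]
          simp only [hη, hH, mul_inv]
          field_simp
          ring
  -- Divided by `T`, everything but `4V` vanishes: the boundary and step-variation terms by `T^(α-1)
  -- log T → 0`, the multiplicative noise by Cesàro since `u → 0`. Positivity of `V` then leaves
  -- room for the constant `5`.
  have hlim : Tendsto (fun T : ℕ => (T : ℝ)⁻¹ * C
      + 6 * (K / η₀ ^ 2) * ((T : ℝ)⁻¹ * ((a T)⁻¹ * (1 + H T)))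
      + 64 * ((T : ℝ)⁻¹ * ∑ t ∈ Finset.range T, u (t + 1))) atTop (𝓝 0) := by
    have l1 : Tendsto (fun T : ℕ => (T : ℝ)⁻¹ * C) atTop (𝓝 0) := by
      simpa using (tendsto_inv_atTop_nhds_zero_nat (𝕜 := ℝ)).mul_const C
    have l2 := (tendsto_inv_stepSize_mul_log hα0 hα1).const_mul (6 * (K / η₀ ^ 2))
    have hu_lim : Tendsto (fun t => u (t + 1)) atTop (𝓝 0) := by
      have : Tendsto u atTop (𝓝 0) := squeeze_zero hu0 hK (by
        have := (tendsto_stepSize hα0).const_mul K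
        rwa [mul_zero] at this)
      exact this.comp (tendsto_add_atTop_nat 1)
    have l3 := hu_lim.cesaro.const_mul 64
    have l4 := (l1.add l2).add l3
    rwa [mul_zero, mul_zero, add_zero, add_zero] at l4
  filter_upwards [hlim.eventually_lt_const hV, eventually_ge_atTop 1] with T hT hT1
  have hT0 : (0 : ℝ) < T := by exact_mod_cast hT1
  have hm := hmain T
  simp_rw [norm_smul, mul_pow]
  rw [integral_const_mul, Real.norm_of_nonneg (by positivity), le_div_iff₀ (by positivity)]
  set I := ∫ x, ‖∑ t ∈ Finset.range T, saError L e η δ₀ x (t + 1)‖ ^ 2 ∂Q with hI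
  have e1 : ((T : ℝ)⁻¹) ^ 2 * I * (κ ^ 2 * T) = (T : ℝ)⁻¹ * (κ ^ 2 * I) := by field_simp
  rw [e1]
  have e2 := mul_le_mul_of_nonneg_left hm (inv_nonneg.2 hT0.le)
  have e3 : (T : ℝ)⁻¹ * (C + 6 * (K / η₀ ^ 2) * ((a T)⁻¹ * (1 + H T)) + 4 * V * T
        + 64 * ∑ t ∈ Finset.range T, u (t + 1))
      = ((T : ℝ)⁻¹ * C + 6 * (K / η₀ ^ 2) * ((T : ℝ)⁻¹ * ((a T)⁻¹ * (1 + H T)))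
      + 64 * ((T : ℝ)⁻¹ * ∑ t ∈ Finset.range T, u (t + 1))) + 4 * V := by field_simp; ring
  rw [e3] at e2
  linarith

end AveragedError

/-! ### Integrals against composed discrete laws. -/

section PMFIntegrals

/-- `PMF.bind` is composition of Markov kernels, for which the iterated integral formula is
available. -/
theorem PMF.integral_bind {α β : Type*} [Countable α] [MeasurableSpace α] [DiscreteMeasurableSpace α]
    [MeasurableSpace β] (p : PMF α) (k : α → PMF β) {f : β → ℝ}
    (hf : Integrable f (p.bind k).toMeasure) :
    ∫ b, f b ∂(p.bind k).toMeasure = ∫ a, ∫ b, f b ∂(k a).toMeasure ∂p.toMeasure := by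
  let K : Kernel α β := ⟨fun a => (k a).toMeasure, measurable_of_countable _⟩
  have hK : (K ∘ₖ Kernel.const Unit p.toMeasure) () = (p.bind k).toMeasure := by
    ext s hs
    rw [Kernel.comp_apply' _ _ _ hs, Kernel.const_apply, PMF.toMeasure_bind_apply _ _ _ hs,
      lintegral_countable']
    refine tsum_congr fun a => ?_
    rw [PMF.toMeasure_apply_singleton _ _ (MeasurableSet.singleton a), mul_comm]
    rfl
  rw [← hK] at hf ⊢
  rw [Kernel.integral_comp hf, Kernel.const_apply]
  rfl

end PMFIntegrals

/-! ### Entrywise integration and empirical means of random matrices. -/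

section MatrixIntegrals

open scoped Matrix.Norms.Frobenius

variable {X : Type*} [MeasurableSpace X] {ν : Measure X} {d : ℕ}

theorem integral_dotProduct_mulVec {N : X → Matrix (Fin d) (Fin d) ℝ}
    (hN : ∀ i j, Integrable (fun y => N y i j) ν) (w v : Fin d → ℝ) :
    ∫ y, w ⬝ᵥ N y *ᵥ v ∂ν = w ⬝ᵥ (Matrix.of fun i j => ∫ y, N y i j ∂ν) *ᵥ v := by
  simp only [dotProduct, mulVec, Finset.mul_sum, Matrix.of_apply]
  rw [integral_finsetSum _ fun i _ => integrable_finsetSum _ fun j _ =>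
    ((hN i j).mul_const _).const_mul _]
  refine Finset.sum_congr rfl fun i _ => ?_
  rw [integral_finsetSum _ fun j _ => ((hN i j).mul_const _).const_mul _]
  refine Finset.sum_congr rfl fun j _ => ?_
  rw [integral_const_mul, integral_mul_const]

theorem frobenius_norm_vecMulVec (a b : Fin d → ℝ) :
    ‖vecMulVec a b‖ = ‖WithLp.toLp 2 a‖ * ‖WithLp.toLp 2 b‖ := by
  refine (sq_eq_sq₀ (norm_nonneg _) (by positivity)).1 ?_
  rw [mul_pow, frobenius_norm_sq_eq_sum, EuclideanSpace.real_norm_sq_eq,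
    EuclideanSpace.real_norm_sq_eq, Finset.sum_mul_sum]
  simp [vecMulVec_apply, mul_pow]

theorem abs_entry_le_frobenius_norm (N : Matrix (Fin d) (Fin d) ℝ) (i j : Fin d) :
    |N i j| ≤ ‖N‖ := by
  refine abs_le_of_sq_le_sq ?_ (norm_nonneg _)
  rw [frobenius_norm_sq_eq_sum]
  exact (Finset.single_le_sum (f := fun j => N i j ^ 2) (fun j _ => sq_nonneg _)
    (Finset.mem_univ j)).trans (Finset.single_le_sum (f := fun i => ∑ j, N i j ^ 2)
      (fun i _ => Finset.sum_nonneg fun j _ => sq_nonneg _) (Finset.mem_univ i))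

variable [Countable X] [DiscreteMeasurableSpace X] [IsProbabilityMeasure ν]

/-- Mean square Frobenius error of an empirical mean of bounded i.i.d. matrices. -/
theorem integral_norm_sq_avg_matrix_le {N : X → Matrix (Fin d) (Fin d) ℝ} {B : ℝ}
    (hB : ∀ y, ‖N y‖ ≤ B) {T : ℕ} (hT : 1 ≤ T) :
    Integrable (fun x : ℕ → X => ‖(T : ℝ)⁻¹ • ∑ t ∈ Finset.range T, N (x t)
        - Matrix.of fun i j => ∫ y, N y i j ∂ν‖ ^ 2) (Measure.infinitePi fun _ : ℕ => ν) ∧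
    ∫ x, ‖(T : ℝ)⁻¹ • ∑ t ∈ Finset.range T, N (x t)
        - Matrix.of fun i j => ∫ y, N y i j ∂ν‖ ^ 2 ∂(Measure.infinitePi fun _ : ℕ => ν)
      ≤ (T : ℝ)⁻¹ * ∫ y, ‖N y‖ ^ 2 ∂ν := by
  have hent : ∀ i j y, |N y i j| ≤ B := fun i j y => (abs_entry_le_frobenius_norm _ i j).trans (hB y)
  have hexp : ∀ x : ℕ → X, ‖(T : ℝ)⁻¹ • ∑ t ∈ Finset.range T, N (x t)
        - Matrix.of fun i j => ∫ y, N y i j ∂ν‖ ^ 2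
      = ∑ i, ∑ j, ((T : ℝ)⁻¹ * ∑ t ∈ Finset.range T, N (x t) i j - ∫ y, N y i j ∂ν) ^ 2 := by
    intro x
    rw [frobenius_norm_sq_eq_sum]
    simp [Matrix.sum_apply]
  have hint : ∀ i j, Integrable (fun x : ℕ → X =>
      ((T : ℝ)⁻¹ * ∑ t ∈ Finset.range T, N (x t) i j - ∫ y, N y i j ∂ν) ^ 2)
      (Measure.infinitePi fun _ : ℕ => ν) := by
    intro i j
    refine integrable_of_dependsOn ν (s := Finset.range T) (fun x x' hx => ?_)
      (B := (|(T : ℝ)⁻¹| * (∑ t ∈ Finset.range T, B) + |∫ y, N y i j ∂ν|) ^ 2) fun x => ?_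
    · congr 3
      exact Finset.sum_congr rfl fun t ht => by rw [hx t (by simpa using ht)]
    · rw [Real.norm_of_nonneg (by positivity), ← sq_abs]
      refine pow_le_pow_left₀ (abs_nonneg _) ((abs_sub _ _).trans (add_le_add ?_ le_rfl)) 2
      rw [abs_mul]
      exact mul_le_mul_of_nonneg_left ((Finset.abs_sum_le_sum_abs _ _).trans
        (Finset.sum_le_sum fun t _ => hent i j _)) (abs_nonneg _)
  have hsq : ∀ i j, Integrable (fun y => N y i j ^ 2) ν := fun i j =>
    integrable_of_abs_le (B := B ^ 2) fun y => by
      rw [abs_of_nonneg (by positivity), ← sq_abs]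
      exact pow_le_pow_left₀ (abs_nonneg _) (hent i j y) 2
  simp_rw [hexp]
  refine ⟨integrable_finsetSum _ fun i _ => integrable_finsetSum _ fun j _ => hint i j, ?_⟩
  rw [integral_finsetSum _ fun i _ => integrable_finsetSum _ fun j _ => hint i j]
  simp_rw [frobenius_norm_sq_eq_sum]
  rw [integral_finsetSum _ fun i _ => integrable_finsetSum _ fun j _ => hsq i j, Finset.mul_sum]
  refine Finset.sum_le_sum fun i _ => ?_
  rw [integral_finsetSum _ fun j _ => hint i j, integral_finsetSum _ fun j _ => hsq i j,
    Finset.mul_sum]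
  exact Finset.sum_le_sum fun j _ => integral_sq_avg_sub_le ν (hent i j) hT

end MatrixIntegrals

/-! ### The smallest eigenvalue as a lower bound of the quadratic form. -/

section Eigenvalues

variable {d : ℕ}

theorem iInf_eigenvalues_mul_le {N : Matrix (Fin d) (Fin d) ℝ} (hN : N.IsHermitian)
    (v : Fin d → ℝ) : (⨅ i, hN.eigenvalues i) * (v ⬝ᵥ v) ≤ v ⬝ᵥ N *ᵥ v := by
  set U : Matrix (Fin d) (Fin d) ℝ := hN.eigenvectorUnitary.1 with hU
  have hU1 : U * Uᵀ = 1 := by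
    simpa [star_eq_conjTranspose] using Unitary.mul_star_self_of_mem hN.eigenvectorUnitary.2
  have hspec : N = U * diagonal hN.eigenvalues * Uᵀ := by
    have := hN.spectral_theorem
    rw [Unitary.conjStarAlgAut_apply] at this
    simpa [star_eq_conjTranspose, Function.comp_def] using this
  set w := Uᵀ *ᵥ v with hw
  have hquad : ∀ D : Matrix (Fin d) (Fin d) ℝ, v ⬝ᵥ (U * D * Uᵀ) *ᵥ v = w ⬝ᵥ D *ᵥ w := by
    intro D
    rw [← mulVec_mulVec, ← mulVec_mulVec, dotProduct_mulVec, ← mulVec_transpose]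
  have h1 : v ⬝ᵥ v = w ⬝ᵥ w := by
    have := hquad 1
    rwa [Matrix.mul_one, hU1, one_mulVec, one_mulVec] at this
  have h2 : v ⬝ᵥ N *ᵥ v = ∑ i, hN.eigenvalues i * w i ^ 2 := by
    conv_lhs => rw [hspec]
    rw [hquad]
    simp only [dotProduct, mulVec_diagonal]
    exact Finset.sum_congr rfl fun i _ => by ring
  rw [h2, h1, dotProduct, Finset.mul_sum]
  refine Finset.sum_le_sum fun i _ => ?_
  rw [← sq]
  exact mul_le_mul_of_nonneg_right (ciInf_le (Set.finite_range _).bddBelow i) (sq_nonneg _)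

end Eigenvalues

/-! ### Temporal difference learning as linear stochastic approximation. -/

section TDFacts

open scoped Matrix.Norms.Frobenius

namespace TDProblem

variable {S A : Type*} {d : ℕ} (M : TDProblem S A d)

theorem sampleLaw_map_pair : M.sampleLaw.map (fun x => (x.1, x.2.2)) = M.pairLaw := by
  simp only [sampleLaw, pairLaw, MDP.inducedKernel, PMF.map_bind, PMF.map_comp]
  rfl

theorem pairLaw_map_fst : M.pairLaw.map Prod.fst = M.stationary := by
  simp only [pairLaw, PMF.map_bind, PMF.map_comp]
  have : ∀ s : S, (PMF.map (Prod.fst ∘ fun s' : S => (s, s')) (M.inducedKernel M.policy s))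
      = PMF.pure s := fun s => PMF.map_const _ s
  simp_rw [this]
  exact PMF.bind_pure _

theorem pairLaw_map_snd : M.pairLaw.map Prod.snd = M.stationary := by
  simp only [pairLaw, PMF.map_bind, PMF.map_comp]
  have : ∀ s : S, (PMF.map (Prod.snd ∘ fun s' : S => (s, s')) (M.inducedKernel M.policy s))
      = M.inducedKernel M.policy s := fun s => PMF.map_id _
  simp_rw [this]
  exact M.isStationary

theorem norm_feature_le (s : S) : ‖WithLp.toLp 2 (M.feature s)‖ ≤ 1 := M.feature_norm_le s

theorem norm_feature_diff_le (s s' : S) :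
    ‖WithLp.toLp 2 (M.feature s - M.discount • M.feature s')‖ ≤ 2 := by
  rw [WithLp.toLp_sub, WithLp.toLp_smul]
  refine (norm_sub_le _ _).trans ?_
  rw [norm_smul, Real.norm_of_nonneg M.discount_nonneg]
  have h1 := M.norm_feature_le s
  have h2 := M.norm_feature_le s'
  have h3 := M.discount_lt_one
  have h4 := M.discount_nonneg
  nlinarith [norm_nonneg (WithLp.toLp 2 (M.feature s'))]

theorem norm_tdMatrix_le (s s' : S) : ‖M.tdMatrix s s'‖ ≤ 2 := by
  rw [tdMatrix, frobenius_norm_vecMulVec]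
  have h1 := M.norm_feature_le s
  have h2 := M.norm_feature_diff_le s s'
  nlinarith [norm_nonneg (WithLp.toLp 2 (M.feature s)),
    norm_nonneg (WithLp.toLp 2 (M.feature s - M.discount • M.feature s'))]

theorem abs_dotProduct_le (v w : Fin d → ℝ) :
    |v ⬝ᵥ w| ≤ ‖WithLp.toLp 2 v‖ * ‖WithLp.toLp 2 w‖ := by
  have := abs_real_inner_le_norm (WithLp.toLp 2 w) (WithLp.toLp 2 v)
  rw [mul_comm ‖WithLp.toLp 2 w‖] at this
  simpa [PiLp.inner_apply, dotProduct] using this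

theorem norm_tdMatrix_mulVec_le (s s' : S) (v : Fin d → ℝ) :
    ‖WithLp.toLp 2 (M.tdMatrix s s' *ᵥ v)‖ ≤ 2 * ‖WithLp.toLp 2 v‖ := by
  rw [tdMatrix, vecMulVec_mulVec, op_smul_eq_smul, WithLp.toLp_smul, norm_smul, Real.norm_eq_abs]
  have h1 := M.norm_feature_le s
  have h2 := M.norm_feature_diff_le s s'
  have h3 := abs_dotProduct_le (M.feature s - M.discount • M.feature s') v
  calc |(M.feature s - M.discount • M.feature s') ⬝ᵥ v| * ‖WithLp.toLp 2 (M.feature s)‖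
      ≤ (2 * ‖WithLp.toLp 2 v‖) * 1 := by
        refine mul_le_mul (h3.trans ?_) h1 (norm_nonneg _) (by positivity)
        gcongr
    _ = _ := mul_one _

theorem abs_feature_le (s : S) (i : Fin d) : |M.feature s i| ≤ 1 :=
  (PiLp.norm_apply_le (WithLp.toLp 2 (M.feature s)) i).trans (M.norm_feature_le s)

theorem norm_sampleB_le (x : S × A × S) : ‖WithLp.toLp 2 (M.sampleB x)‖ ≤ 1 := by
  rw [sampleB, WithLp.toLp_smul, norm_smul, Real.norm_of_nonneg (M.reward_nonneg _ _)]
  have h1 := M.norm_feature_le x.1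
  have h2 := M.reward_le_one x.1 x.2.1
  have h3 := M.reward_nonneg x.1 x.2.1
  nlinarith [norm_nonneg (WithLp.toLp 2 (M.feature x.1))]

variable [Countable S] [Countable A] [MeasurableSpace S] [DiscreteMeasurableSpace S]
  [MeasurableSpace A] [DiscreteMeasurableSpace A]

theorem map_pair_toMeasure :
    M.sampleLaw.toMeasure.map (fun x => (x.1, x.2.2)) = M.pairLaw.toMeasure := by
  rw [PMF.toMeasure_map _ _ (measurable_of_countable _), sampleLaw_map_pair]

theorem integrable_sampleA (i j : Fin d) :
    Integrable (fun x => M.sampleA x i j) M.sampleLaw.toMeasure :=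
  integrable_of_abs_le (B := 2) fun _ =>
    (abs_entry_le_frobenius_norm _ i j).trans (M.norm_tdMatrix_le _ _)

theorem integral_sampleA :
    (Matrix.of fun i j => ∫ x, M.sampleA x i j ∂M.sampleLaw.toMeasure) = M.meanA := by
  ext i j
  simp only [meanA, Matrix.of_apply]
  rw [← map_pair_toMeasure, integral_map (measurable_of_countable _).aemeasurable
    (measurable_of_countable _).aestronglyMeasurable]
  rfl

/-- The feature depends on the state alone, so averaging over the action given the state turns `r(s,
a)` into the policy reward. -/
theorem integral_sampleB (i : Fin d) :
    ∫ x, M.sampleB x i ∂M.sampleLaw.toMeasure = M.meanB i := by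
  have hb : ∀ x, |M.sampleB x i| ≤ 1 := fun x =>
    (PiLp.norm_apply_le (WithLp.toLp 2 (M.sampleB x)) i).trans (M.norm_sampleB_le x)
  simp only [meanB, sampleLaw]
  rw [PMF.integral_bind _ _ (integrable_of_abs_le hb)]
  refine integral_congr_ae (ae_of_all _ fun s => ?_)
  simp only
  rw [PMF.integral_bind _ _ (integrable_of_abs_le hb), policyReward, ← integral_mul_const]
  refine integral_congr_ae (ae_of_all _ fun a => ?_)
  simp only
  rw [← PMF.toMeasure_map _ _ (measurable_of_countable _),
    integral_map (measurable_of_countable _).aemeasurable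
      (measurable_of_countable _).aestronglyMeasurable]
  simp [sampleB]

omit [Countable A] [MeasurableSpace A] [DiscreteMeasurableSpace A] in
theorem integrable_featureCov (i j : Fin d) :
    Integrable (fun s => vecMulVec (M.feature s) (M.feature s) i j) M.stationary.toMeasure :=
  integrable_of_abs_le (B := 1) fun s => by
    rw [vecMulVec_apply, abs_mul]
    exact mul_le_one₀ (M.abs_feature_le s i) (abs_nonneg _) (M.abs_feature_le s j)

omit [Countable A] [MeasurableSpace A] [DiscreteMeasurableSpace A] in
theorem featureCov_quadratic (v : Fin d → ℝ) :
    ∫ s, (M.feature s ⬝ᵥ v) ^ 2 ∂M.stationary.toMeasure = v ⬝ᵥ M.featureCov *ᵥ v := by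
  have h := integral_dotProduct_mulVec (M.integrable_featureCov) v v
  have h2 : (Matrix.of fun i j => ∫ s, vecMulVec (M.feature s) (M.feature s) i j
      ∂M.stationary.toMeasure) = M.featureCov := by
    ext i j; simp [featureCov, vecMulVec_apply]
  rw [h2] at h
  rw [← h]
  refine integral_congr_ae (ae_of_all _ fun s => ?_)
  simp only
  rw [vecMulVec_mulVec, op_smul_eq_smul, dotProduct_smul, smul_eq_mul, sq, dotProduct_comm v]

omit [Countable S] [Countable A] [DiscreteMeasurableSpace S] [MeasurableSpace A]
  [DiscreteMeasurableSpace A] in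
theorem lambdaZero_mul_le (v : Fin d → ℝ) :
    M.lambdaZero * (v ⬝ᵥ v) ≤ v ⬝ᵥ M.featureCov *ᵥ v :=
  iInf_eigenvalues_mul_le M.featureCov_isHermitian v

/-- With `f = φ · v`, the form is the mean of `f(s)(f(s) - γ f(s'))`. By AM-GM it is at least `(1 -
γ/2) E f(s)² - (γ/2) E f(s')²`, and stationarity makes the two second moments equal. -/
theorem meanA_coercive (v : Fin d → ℝ) :
    (1 - M.discount) * M.lambdaZero * (v ⬝ᵥ v) ≤ v ⬝ᵥ M.meanA *ᵥ v := by
  set f : S → ℝ := fun s => M.feature s ⬝ᵥ v with hf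
  have hfb : ∀ s, |f s ^ 2| ≤ ‖WithLp.toLp 2 v‖ ^ 2 := fun s => by
    rw [abs_of_nonneg (by positivity), ← sq_abs]
    refine pow_le_pow_left₀ (abs_nonneg _) ((abs_dotProduct_le _ _).trans ?_) 2
    have := M.norm_feature_le s
    nlinarith [norm_nonneg (WithLp.toLp 2 v)]
  have h := integral_dotProduct_mulVec (M.integrable_sampleA) v v
  rw [integral_sampleA] at h
  have hfst : M.sampleLaw.toMeasure.map (fun x => x.1) = M.stationary.toMeasure := by
    rw [← M.pairLaw_map_fst, ← M.sampleLaw_map_pair, PMF.map_comp,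
      PMF.toMeasure_map _ _ (measurable_of_countable _)]
    rfl
  have hsnd : M.sampleLaw.toMeasure.map (fun x => x.2.2) = M.stationary.toMeasure := by
    rw [← M.pairLaw_map_snd, ← M.sampleLaw_map_pair, PMF.map_comp,
      PMF.toMeasure_map _ _ (measurable_of_countable _)]
    rfl
  have i1 : ∫ x, f x.1 ^ 2 ∂M.sampleLaw.toMeasure = v ⬝ᵥ M.featureCov *ᵥ v := by
    rw [← featureCov_quadratic, ← hfst, integral_map (measurable_of_countable _).aemeasurable
      (measurable_of_countable _).aestronglyMeasurable]
  have i2 : ∫ x, f x.2.2 ^ 2 ∂M.sampleLaw.toMeasure = v ⬝ᵥ M.featureCov *ᵥ v := by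
    rw [← featureCov_quadratic, ← hsnd, integral_map (measurable_of_countable _).aemeasurable
      (measurable_of_countable _).aestronglyMeasurable]
  have j1 : Integrable (fun x : S × A × S => f x.1 ^ 2) M.sampleLaw.toMeasure :=
    integrable_of_abs_le fun x => hfb x.1
  have j2 : Integrable (fun x : S × A × S => f x.2.2 ^ 2) M.sampleLaw.toMeasure :=
    integrable_of_abs_le fun x => hfb x.2.2
  have hval : ∀ x, v ⬝ᵥ M.sampleA x *ᵥ v = f x.1 * (f x.1 - M.discount * f x.2.2) := by
    intro x
    rw [sampleA, tdMatrix, vecMulVec_mulVec, op_smul_eq_smul, dotProduct_smul, smul_eq_mul,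
      sub_dotProduct, smul_dotProduct, smul_eq_mul, dotProduct_comm v]
    ring
  have hlow : ∫ x, ((1 - M.discount / 2) * f x.1 ^ 2 - M.discount / 2 * f x.2.2 ^ 2)
      ∂M.sampleLaw.toMeasure ≤ v ⬝ᵥ M.meanA *ᵥ v := by
    rw [← h]
    refine integral_mono ((j1.const_mul _).sub (j2.const_mul _))
      (integrable_of_abs_le (B := ‖WithLp.toLp 2 v‖ * (2 * ‖WithLp.toLp 2 v‖)) fun x => ?_)
      fun x => ?_
    · exact (abs_dotProduct_le _ _).trans (mul_le_mul_of_nonneg_left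
        (M.norm_tdMatrix_mulVec_le _ _ v) (norm_nonneg _))
    · simp only
      rw [hval]
      nlinarith [mul_nonneg M.discount_nonneg (sq_nonneg (f x.1 - f x.2.2))]
  rw [integral_sub (j1.const_mul _) (j2.const_mul _), integral_const_mul, integral_const_mul,
    i1, i2] at hlow
  have := mul_le_mul_of_nonneg_left (M.lambdaZero_mul_le v)
    (sub_nonneg.2 M.discount_lt_one.le)
  linarith

omit [Countable A] [MeasurableSpace A] [DiscreteMeasurableSpace A] in
-- Tested on a coordinate vector, since features lie in the unit ball. This gives `κ ≤ 1`, so that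
-- bounds with `√Tr Γ` can be absorbed into `√Tr Γ / κ`.
theorem lambdaZero_le_one (hd : 0 < d) : M.lambdaZero ≤ 1 := by
  have h := M.lambdaZero_mul_le (Pi.single ⟨0, hd⟩ 1)
  rw [← featureCov_quadratic] at h
  simp only [dotProduct_single, mul_one, Pi.single_eq_same] at h
  refine h.trans ?_
  have := norm_integral_le_of_norm_le_const (μ := M.stationary.toMeasure)
    (f := fun s => M.feature s ⟨0, hd⟩ ^ 2) (C := 1) (ae_of_all _ fun s => by
      rw [Real.norm_of_nonneg (by positivity), ← sq_abs]
      exact pow_le_one₀ (abs_nonneg _) (M.abs_feature_le s _))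
  simp only [probReal_univ, mul_one] at this
  exact (le_abs_self _).trans this

omit [Countable S] [Countable A] [DiscreteMeasurableSpace S] [MeasurableSpace A]
  [DiscreteMeasurableSpace A] in
-- In dimension `0` the infimum over an empty family of reals is `0` by convention.
theorem dim_pos (h : 0 < M.lambdaZero) : 0 < d := by
  rcases Nat.eq_zero_or_pos d with rfl | hd
  · simp [lambdaZero] at h
  · exact hd

omit [Countable S] [Countable A] [DiscreteMeasurableSpace S] [DiscreteMeasurableSpace A] in
theorem norm_noise_le (x : S × A × S) :
    ‖WithLp.toLp 2 (M.noise x)‖ ≤ 2 * (euclNorm M.thetaStar + 1) := by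
  rw [noise, WithLp.toLp_sub]
  have h1 := M.norm_tdMatrix_mulVec_le x.1 x.2.2 M.thetaStar
  have h2 := M.norm_sampleB_le x
  refine (norm_sub_le _ _).trans ((add_le_add h1 h2).trans ?_)
  rw [euclNorm]
  linarith

theorem integrable_noise (i : Fin d) :
    Integrable (fun x => M.noise x i) M.sampleLaw.toMeasure :=
  integrable_of_abs_le fun x =>
    (PiLp.norm_apply_le (WithLp.toLp 2 (M.noise x)) i).trans (M.norm_noise_le x)

theorem meanA_mulVec_thetaStar (h : 0 < M.lambdaZero) : M.meanA *ᵥ M.thetaStar = M.meanB := by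
  have hdet := isUnit_det_of_coercive (mul_pos (sub_pos.2 M.discount_lt_one) h) M.meanA_coercive
  rw [thetaStar, mulVec_mulVec, mul_nonsing_inv _ hdet, one_mulVec]

/-- The noise at `θ*` is centered because of the normal equation `A θ* = b`. -/
theorem integral_noise (h : 0 < M.lambdaZero) (i : Fin d) :
    ∫ x, M.noise x i ∂M.sampleLaw.toMeasure = 0 := by
  have hB : Integrable (fun x => M.sampleB x i) M.sampleLaw.toMeasure :=
    integrable_of_abs_le fun x =>
      (PiLp.norm_apply_le (WithLp.toLp 2 (M.sampleB x)) i).trans (M.norm_sampleB_le x)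
  have hA : ∀ j, Integrable (fun x => M.sampleA x i j * M.thetaStar j) M.sampleLaw.toMeasure :=
    fun j => (M.integrable_sampleA i j).mul_const _
  have h1 : ∀ x, M.noise x i = ∑ j, M.sampleA x i j * M.thetaStar j - M.sampleB x i := fun x => rfl
  simp_rw [h1]
  rw [integral_sub (integrable_finsetSum _ fun j _ => hA j) hB, integral_sampleB,
    integral_finsetSum _ fun j _ => hA j, ← M.meanA_mulVec_thetaStar h, ← integral_sampleA]
  simp [mulVec, dotProduct, integral_mul_const]

theorem integrable_noise_mul (i j : Fin d) :
    Integrable (fun x => vecMulVec (M.noise x) (M.noise x) i j) M.sampleLaw.toMeasure :=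
  integrable_of_abs_le (B := (2 * (euclNorm M.thetaStar + 1)) * (2 * (euclNorm M.thetaStar + 1)))
    fun x => (abs_entry_le_frobenius_norm _ i j).trans (by
      rw [frobenius_norm_vecMulVec]
      exact mul_le_mul (M.norm_noise_le x) (M.norm_noise_le x) (norm_nonneg _)
        ((norm_nonneg _).trans (M.norm_noise_le x)))

omit [Countable S] [Countable A] [DiscreteMeasurableSpace S] [DiscreteMeasurableSpace A] in
theorem noiseCov_eq : (Matrix.of fun i j => ∫ x, vecMulVec (M.noise x) (M.noise x) i j
    ∂M.sampleLaw.toMeasure) = M.noiseCov := by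
  ext i j; simp [noiseCov, vecMulVec_apply]

theorem noiseCov_posDef (h : IsUnit M.noiseCov.det) : M.noiseCov.PosDef := by
  have hps : M.noiseCov.PosSemidef := by
    refine Matrix.PosSemidef.of_dotProduct_mulVec_nonneg ?_ fun v => ?_
    · ext i j
      simp [noiseCov, conjTranspose_apply, mul_comm]
    · have h1 := integral_dotProduct_mulVec (M.integrable_noise_mul) v v
      rw [noiseCov_eq] at h1
      rw [star_trivial, ← h1]
      refine integral_nonneg fun x => ?_
      simp only [Pi.zero_apply]
      rw [vecMulVec_mulVec, op_smul_eq_smul, dotProduct_smul, smul_eq_mul, dotProduct_comm v]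
      exact mul_self_nonneg _
  exact hps.posDef_iff_isUnit.2 ((isUnit_iff_isUnit_det _).2 h)

theorem integral_norm_sq_noise :
    ∫ x, ‖WithLp.toLp 2 (M.noise x)‖ ^ 2 ∂M.sampleLaw.toMeasure = M.noiseCov.trace := by
  simp_rw [EuclideanSpace.real_norm_sq_eq]
  have hi : ∀ i, Integrable (fun x => M.noise x i ^ 2) M.sampleLaw.toMeasure := fun i => by
    have := M.integrable_noise_mul i i
    simpa [vecMulVec_apply, sq] using this
  rw [integral_finsetSum _ fun i _ => hi i]
  simp [Matrix.trace, noiseCov, sq]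

/-- Temporal difference learning as a linear stochastic approximation scheme. -/
theorem isLinearSA (h : 0 < M.lambdaZero) :
    IsLinearSA M.sampleLaw.toMeasure (fun x => toEuclideanCLM (n := Fin d) (𝕜 := ℝ) (M.sampleA x))
      (fun x => WithLp.toLp 2 (M.noise x)) (toEuclideanCLM (n := Fin d) (𝕜 := ℝ) M.meanA)
      ((1 - M.discount) * M.lambdaZero) (2 * (euclNorm M.thetaStar + 1)) where
  norm_le y v := M.norm_tdMatrix_mulVec_le y.1 y.2.2 v.ofLp
  noise_le y := M.norm_noise_le y
  mean w v := by
    simp_rw [inner_toEuclideanCLM]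
    rw [integral_dotProduct_mulVec M.integrable_sampleA, integral_sampleA]
  noise_mean w := by
    simp only [PiLp.inner_apply, RCLike.inner_apply, conj_trivial]
    rw [integral_finsetSum _ fun i _ => (M.integrable_noise i).mul_const _]
    simp_rw [integral_mul_const, M.integral_noise h]
    simp
  coercive v := by
    rw [inner_toEuclideanCLM]
    have := M.meanA_coercive v.ofLp
    rwa [← norm_toLp_sq] at this

omit [Countable S] [Countable A] [DiscreteMeasurableSpace S] [DiscreteMeasurableSpace A] in
/-- The error of the iterates satisfies the linear recursion. -/
theorem iterate_sub_thetaStar (η₀ α : ℝ) (θ₀ : Fin d → ℝ) (x : ℕ → S × A × S) (t : ℕ) :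
    WithLp.toLp 2 (M.iterate η₀ α θ₀ x t - M.thetaStar)
      = saError (fun x => toEuclideanCLM (n := Fin d) (𝕜 := ℝ) (M.sampleA x))
          (fun x => WithLp.toLp 2 (M.noise x)) (fun t => η₀ * ((t + 1 : ℕ) : ℝ) ^ (-α))
          (WithLp.toLp 2 (θ₀ - M.thetaStar)) x t := by
  induction t with
  | zero => rfl
  | succ t ih =>
    rw [saError, ← ih, toEuclideanCLM_toLp, ← WithLp.toLp_add, ← WithLp.toLp_smul,
      ← WithLp.toLp_sub, iterate, noise, mulVec_sub]
    congr 1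
    rw [sub_add_sub_cancel]
    abel

omit [Countable S] [Countable A] [DiscreteMeasurableSpace S] [DiscreteMeasurableSpace A] in
theorem avgIterate_sub_thetaStar (η₀ α : ℝ) (θ₀ : Fin d → ℝ) (x : ℕ → S × A × S) {T : ℕ}
    (hT : 1 ≤ T) :
    WithLp.toLp 2 (M.avgIterate η₀ α θ₀ x T - M.thetaStar)
      = (T : ℝ)⁻¹ • ∑ t ∈ Finset.range T,
          saError (fun x => toEuclideanCLM (n := Fin d) (𝕜 := ℝ) (M.sampleA x))
          (fun x => WithLp.toLp 2 (M.noise x)) (fun t => η₀ * ((t + 1 : ℕ) : ℝ) ^ (-α))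
          (WithLp.toLp 2 (θ₀ - M.thetaStar)) x (t + 1) := by
  have hT' : (T : ℝ) ≠ 0 := by positivity
  have hsum : ∀ f : ℕ → Fin d → ℝ, ∑ t ∈ Finset.Icc 1 T, f t = ∑ t ∈ Finset.range T, f (t + 1) := by
    intro f
    rw [Finset.range_eq_Ico, Finset.sum_Ico_add' f 0 T 1]
    rfl
  simp_rw [← iterate_sub_thetaStar]
  rw [avgIterate, hsum, ← WithLp.toLp_sum, ← WithLp.toLp_smul]
  congr 1
  rw [Finset.sum_sub_distrib, smul_sub, Finset.sum_const, Finset.card_range,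
    ← Nat.cast_smul_eq_nsmul ℝ, smul_smul, inv_mul_cancel₀ hT', one_smul]

end TDProblem

end TDFacts

/-! ### From concentration of the empirical quantities to the Gaussian bound. -/

section PlugInBounds

open scoped Matrix.Norms.Frobenius
open Topology

namespace TDProblem

variable {S A : Type*} {d : ℕ} (M : TDProblem S A d)

theorem estNoiseCov_posSemidef (η₀ α : ℝ) (θ₀ : Fin d → ℝ) (x : ℕ → S × A × S) (T : ℕ) :
    (M.estNoiseCov η₀ α θ₀ x T).PosSemidef := by
  refine Matrix.PosSemidef.smul (posSemidef_sum _ fun t _ => ?_) (by positivity)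
  simpa using posSemidef_vecMulVec_self_star (M.residual η₀ α θ₀ x T t)

variable [MeasurableSpace S] [MeasurableSpace A]

/-- The residual is the noise at `θ*` plus `A_t (θ̄_T - θ*)`. The remaining terms are bounded
pathwise, so the dependence between `θ̄_T` and `A_t` does no harm. -/
theorem norm_estNoiseCov_sub_le [Countable S] [Countable A] [DiscreteMeasurableSpace S]
    [DiscreteMeasurableSpace A] (η₀ α : ℝ) (θ₀ : Fin d → ℝ) (x : ℕ → S × A × S) {T : ℕ}
    (hT : 1 ≤ T) :
    ‖M.estNoiseCov η₀ α θ₀ x T - M.noiseCov‖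
      ≤ ‖(T : ℝ)⁻¹ • ∑ t ∈ Finset.range T, vecMulVec (M.noise (x t)) (M.noise (x t)) - M.noiseCov‖
        + 8 * (euclNorm M.thetaStar + 1)
          * ‖WithLp.toLp 2 (M.avgIterate η₀ α θ₀ x T - M.thetaStar)‖
        + 4 * ‖WithLp.toLp 2 (M.avgIterate η₀ α θ₀ x T - M.thetaStar)‖ ^ 2 := by
  set v := M.avgIterate η₀ α θ₀ x T - M.thetaStar with hv
  set m := euclNorm M.thetaStar + 1 with hm
  set D := ‖WithLp.toLp 2 v‖ with hD
  have hT0 : (0 : ℝ) < T := by exact_mod_cast hT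
  set n : ℕ → Fin d → ℝ := fun t => M.noise (x t) with hn
  set q : ℕ → Fin d → ℝ := fun t => M.sampleA (x t) *ᵥ v with hq
  have hres : ∀ t, M.residual η₀ α θ₀ x T t = n t + q t := by
    intro t
    simp only [residual, hn, hq, noise, hv, mulVec_sub]
    abel
  have hnb : ∀ t, ‖WithLp.toLp 2 (n t)‖ ≤ 2 * m := fun t => M.norm_noise_le (x t)
  have hqb : ∀ t, ‖WithLp.toLp 2 (q t)‖ ≤ 2 * D := fun t => M.norm_tdMatrix_mulVec_le _ _ v
  have hdecomp : M.estNoiseCov η₀ α θ₀ x T - M.noiseCov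
      = ((T : ℝ)⁻¹ • ∑ t ∈ Finset.range T, vecMulVec (n t) (n t) - M.noiseCov)
        + (T : ℝ)⁻¹ • ∑ t ∈ Finset.range T,
          (vecMulVec (n t) (q t) + vecMulVec (q t) (n t) + vecMulVec (q t) (q t)) := by
    rw [estNoiseCov]
    have : ∀ t, vecMulVec (M.residual η₀ α θ₀ x T t) (M.residual η₀ α θ₀ x T t)
        = vecMulVec (n t) (n t)
          + (vecMulVec (n t) (q t) + vecMulVec (q t) (n t) + vecMulVec (q t) (q t)) := by
      intro t
      rw [hres, vecMulVec_add, add_vecMulVec, add_vecMulVec]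
      abel
    simp_rw [this]
    rw [Finset.sum_add_distrib, smul_add]
    abel
  rw [hdecomp]
  have hterm : ∀ t, ‖vecMulVec (n t) (q t) + vecMulVec (q t) (n t) + vecMulVec (q t) (q t)‖
      ≤ 8 * m * D + 4 * D ^ 2 := by
    intro t
    refine (norm_add_le _ _).trans ((add_le_add (norm_add_le _ _) le_rfl).trans ?_)
    rw [frobenius_norm_vecMulVec, frobenius_norm_vecMulVec, frobenius_norm_vecMulVec]
    have h1 := mul_le_mul (hnb t) (hqb t) (norm_nonneg _) ((norm_nonneg _).trans (hnb t))
    have h2 := mul_le_mul (hqb t) (hqb t) (norm_nonneg _) ((norm_nonneg _).trans (hqb t))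
    nlinarith
  have havg : ‖(T : ℝ)⁻¹ • ∑ t ∈ Finset.range T,
      (vecMulVec (n t) (q t) + vecMulVec (q t) (n t) + vecMulVec (q t) (q t))‖
      ≤ 8 * m * D + 4 * D ^ 2 := by
    rw [norm_smul, Real.norm_of_nonneg (by positivity)]
    have h1 := (norm_sum_le (Finset.range T) fun t =>
      vecMulVec (n t) (q t) + vecMulVec (q t) (n t) + vecMulVec (q t) (q t)).trans
      (Finset.sum_le_sum fun t _ => hterm t)
    rw [Finset.sum_const, Finset.card_range, nsmul_eq_mul] at h1
    rw [inv_mul_le_iff₀ hT0]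
    exact h1
  exact (norm_add_le _ _).trans (by linarith)

theorem noiseCov_trace_le [Countable S] [Countable A] [DiscreteMeasurableSpace S]
    [DiscreteMeasurableSpace A] :
    M.noiseCov.trace ≤ (2 * (euclNorm M.thetaStar + 1)) ^ 2 := by
  rw [← integral_norm_sq_noise]
  have := norm_integral_le_of_norm_le_const (μ := M.sampleLaw.toMeasure)
    (f := fun x => ‖WithLp.toLp 2 (M.noise x)‖ ^ 2) (ae_of_all _ fun x => by
      rw [Real.norm_of_nonneg (by positivity)]
      exact pow_le_pow_left₀ (norm_nonneg _) (M.norm_noise_le x) 2)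
  simp only [probReal_univ, mul_one] at this
  exact (le_abs_self _).trans this

/-- The deterministic part of the argument: on the event that the empirical quantities are close
to their means, the two Gaussian laws are close. -/
theorem tvDist_le_of_concentration [Countable S] [Countable A] [DiscreteMeasurableSpace S]
    [DiscreteMeasurableSpace A] (hlam : 0 < M.lambdaZero) (hdet : IsUnit M.noiseCov.det)
    (η₀ α : ℝ) (θ₀ : Fin d → ℝ) (x : ℕ → S × A × S) {T : ℕ} (hT : 1 ≤ T) {τ : ℝ} (hτ : 0 ≤ τ)
    (h1 : ‖(T : ℝ)⁻¹ • ∑ t ∈ Finset.range T, vecMulVec (M.noise (x t)) (M.noise (x t))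
      - M.noiseCov‖ ≤ 2 * (euclNorm M.thetaStar + 1) * √M.noiseCov.trace * τ)
    (h2 : ‖M.avgA x T - M.meanA‖ ≤ 2 * τ)
    (h3 : ‖WithLp.toLp 2 (M.avgIterate η₀ α θ₀ x T - M.thetaStar)‖
      ≤ 9 / 4 * (√M.noiseCov.trace / (M.lambdaZero * (1 - M.discount))) * τ)
    (h4 : 9 / 4 * (√M.noiseCov.trace / (M.lambdaZero * (1 - M.discount))) * τ
      ≤ euclNorm M.thetaStar + 1) :
    tvDist (centeredGaussian (M.estAsympCov η₀ α θ₀ x T)) (centeredGaussian M.asympCov)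
      ≤ 150 * (√M.noiseCov.trace / (M.lambdaZero * (1 - M.discount))
          * (euclNorm M.thetaStar + 1) * spectralNorm₂ M.noiseCov⁻¹ * τ) := by
  have hγ : 0 < 1 - M.discount := sub_pos.2 M.discount_lt_one
  have hκ : 0 < (1 - M.discount) * M.lambdaZero := mul_pos hγ hlam
  have hpd := M.noiseCov_posDef hdet
  have hd := M.dim_pos hlam
  have hmain := tvDist_plugin_le (B := M.avgA x T) hκ M.meanA_coercive hpd
    (M.estNoiseCov_posSemidef η₀ α θ₀ x T)
  have hG := M.norm_estNoiseCov_sub_le η₀ α θ₀ x hT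
  have hV := M.noiseCov_trace_le
  have hgV := one_le_spectralNorm₂_inv_mul_trace hpd hd
  have hg0 := spectralNorm₂_nonneg M.noiseCov⁻¹
  set g := spectralNorm₂ M.noiseCov⁻¹ with hg
  set m := euclNorm M.thetaStar + 1 with hm
  have hm1 : 1 ≤ m := by rw [hm, euclNorm]; linarith [norm_nonneg (WithLp.toLp 2 M.thetaStar)]
  set V := M.noiseCov.trace with hVdef
  set D := ‖WithLp.toLp 2 (M.avgIterate η₀ α θ₀ x T - M.thetaStar)‖ with hD
  have hD0 : 0 ≤ D := norm_nonneg _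
  rw [mul_comm M.lambdaZero] at h3 h4 ⊢
  set κ := (1 - M.discount) * M.lambdaZero with hκdef
  have hκ1 : κ ≤ 1 := by
    have := M.lambdaZero_le_one hd
    have := M.discount_nonneg
    nlinarith
  have hK : √V ≤ √V / κ := by
    rw [le_div_iff₀ hκ]; nlinarith [Real.sqrt_nonneg V]
  set K := √V / κ with hKdef
  have hK0 : 0 ≤ K := by positivity
  -- From `1 ≤ g Tr Γ ≤ g (2m)²`. It brings the term with `√g` to the form `m g` of the claim.
  have hsg : √g ≤ 2 * m * g := by
    have e1 : 1 ≤ g * (2 * m) ^ 2 := hgV.trans (mul_le_mul_of_nonneg_left hV hg0)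
    have e2 : √g ^ 2 = g := Real.sq_sqrt hg0
    have e3 : 1 ≤ 2 * m * √g := by
      have : (1 : ℝ) ≤ (2 * m * √g) ^ 2 := by rw [mul_pow, e2]; linarith
      have h0 : 0 ≤ 2 * m * √g := by positivity
      nlinarith
    have e4 := mul_le_mul_of_nonneg_right e3 (Real.sqrt_nonneg g)
    have e5 : 2 * m * √g * √g = 2 * m * g := by rw [mul_assoc, ← sq, e2]
    linarith
  have hG0 : 2 * m * √V * τ ≤ 2 * m * K * τ := by gcongr
  have hDD : D ^ 2 ≤ m * D := by rw [sq]; exact mul_le_mul_of_nonneg_right (h3.trans h4) hD0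
  have hmD : m * D ≤ m * (9 / 4 * K * τ) := mul_le_mul_of_nonneg_left h3 (by linarith)
  -- The constant is `2 + 8 · 9/4 + 4 · 9/4`, the square having been linearised by `D ≤ m`.
  have hGb : ‖M.estNoiseCov η₀ α θ₀ x T - M.noiseCov‖ ≤ 29 * (m * K * τ) := by
    nlinarith
  have hA : √g * ‖M.avgA x T - M.meanA‖ * K ≤ 4 * (m * g * τ * K) := by
    calc √g * ‖M.avgA x T - M.meanA‖ * K ≤ (2 * m * g) * (2 * τ) * K := by gcongr
      _ = _ := by ring
  have hgG := mul_le_mul_of_nonneg_left hGb hg0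
  have hnn : 0 ≤ K * m * g * τ := by positivity
  -- In total `3 · 29 + 9 · 4 = 123 ≤ 150`.
  refine hmain.trans ?_
  nlinarith

end TDProblem

end PlugInBounds

/-! ### Concentration on the canonical sample space. -/

section Main

open scoped Matrix.Norms.Frobenius
open Topology

namespace TDProblem

variable {S A : Type*} [Countable S] [Countable A] [MeasurableSpace S] [DiscreteMeasurableSpace S]
  [MeasurableSpace A] [DiscreteMeasurableSpace A] {d : ℕ} (M : TDProblem S A d)

/-- With high probability under the law of the sample sequence, all the empirical quantities are
close to their means. -/
theorem eventually_concentration (hlam : 0 < M.lambdaZero) (hdet : IsUnit M.noiseCov.det)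
    {η₀ α : ℝ} (hη₀ : 0 < η₀) (hα0 : 0 < α) (hα1 : α < 1) (θ₀ : Fin d → ℝ) :
    ∀ᶠ T : ℕ in atTop, ∃ G : Set (ℕ → S × A × S), MeasurableSet G ∧
      1 - 3 * (T : ℝ) ^ (-(1 / 3) : ℝ)
        ≤ (Measure.infinitePi fun _ : ℕ => M.sampleLaw.toMeasure).real G ∧
      ∀ x ∈ G, tvDist (centeredGaussian (M.estAsympCov η₀ α θ₀ x T)) (centeredGaussian M.asympCov)
        ≤ 150 * (√M.noiseCov.trace / (M.lambdaZero * (1 - M.discount))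
          * (euclNorm M.thetaStar + 1) * spectralNorm₂ M.noiseCov⁻¹ * (T : ℝ) ^ (-(1 / 3) : ℝ)) := by
  have hγ : 0 < 1 - M.discount := sub_pos.2 M.discount_lt_one
  have hκ : 0 < (1 - M.discount) * M.lambdaZero := mul_pos hγ hlam
  have hd := M.dim_pos hlam
  have hSA := M.isLinearSA hlam
  have hV : 0 < M.noiseCov.trace := by
    have h1 := one_le_spectralNorm₂_inv_mul_trace (M.noiseCov_posDef hdet) hd
    have h2 := spectralNorm₂_nonneg M.noiseCov⁻¹
    by_contra h
    nlinarith [not_lt.1 h]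
  set m := euclNorm M.thetaStar + 1 with hm
  have hm1 : 1 ≤ m := by rw [hm, euclNorm]; linarith [norm_nonneg (WithLp.toLp 2 M.thetaStar)]
  set V := M.noiseCov.trace with hVdef
  set K := √V / (M.lambdaZero * (1 - M.discount)) with hK
  have hK0 : 0 < K := div_pos (Real.sqrt_pos.2 hV) (by positivity)
  have hevent := hSA.eventually_integral_norm_sq_avg_le (δ₀ := WithLp.toLp 2 (θ₀ - M.thetaStar)) hκ
    hη₀ hα0 hα1 (by rw [M.integral_norm_sq_noise]; exact hV)
  have hτlim : Tendsto (fun T : ℕ => 9 / 4 * K * (T : ℝ) ^ (-(1 / 3) : ℝ)) atTop (𝓝 0) := by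
    have := ((tendsto_rpow_neg_atTop (y := 1 / 3) (by norm_num)).comp
      (tendsto_natCast_atTop_atTop (R := ℝ))).const_mul (9 / 4 * K)
    rwa [mul_zero] at this
  filter_upwards [hevent, eventually_ge_atTop 1, hτlim.eventually_le_const (by linarith : 0 < m)]
    with T hT hT1 hTm
  set Q := Measure.infinitePi fun _ : ℕ => M.sampleLaw.toMeasure with hQ
  have hT0 : (0 : ℝ) < T := by exact_mod_cast hT1
  set τ := (T : ℝ) ^ (-(1 / 3) : ℝ) with hτ
  have hτ0 : 0 ≤ τ := Real.rpow_nonneg hT0.le _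
  set f₁ : (ℕ → S × A × S) → ℝ := fun x => ‖(T : ℝ)⁻¹ • ∑ t ∈ Finset.range T,
    vecMulVec (M.noise (x t)) (M.noise (x t)) - M.noiseCov‖ with hf₁
  set f₂ : (ℕ → S × A × S) → ℝ := fun x => ‖M.avgA x T - M.meanA‖ with hf₂
  set f₃ : (ℕ → S × A × S) → ℝ := fun x =>
    ‖WithLp.toLp 2 (M.avgIterate η₀ α θ₀ x T - M.thetaStar)‖ with hf₃
  have hnn : ∀ y, ‖vecMulVec (M.noise y) (M.noise y)‖ ≤ (2 * m) ^ 2 := fun y => by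
    rw [frobenius_norm_vecMulVec, ← sq]
    exact pow_le_pow_left₀ (norm_nonneg _) (M.norm_noise_le y) 2
  obtain ⟨i1, b1⟩ := integral_norm_sq_avg_matrix_le (ν := M.sampleLaw.toMeasure) hnn hT1
  obtain ⟨i2, b2⟩ := integral_norm_sq_avg_matrix_le (ν := M.sampleLaw.toMeasure)
    (fun y => M.norm_tdMatrix_le y.1 y.2.2) hT1
  rw [noiseCov_eq] at i1 b1
  have eA : (Matrix.of fun i j => ∫ y, M.tdMatrix y.1 y.2.2 i j ∂M.sampleLaw.toMeasure) = M.meanA :=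
    M.integral_sampleA
  rw [eA] at i2 b2
  -- The Frobenius norm of the outer product of the noise `n` with itself is `‖n‖²`. Bounding only
  -- one factor of `‖n‖⁴` by `(2m)²` keeps the other as `Tr Γ`, so `√Tr Γ` survives in the rate.
  have c1 : ∫ x, f₁ x ^ 2 ∂Q ≤ (2 * m * √V) ^ 2 / T := by
    refine b1.trans ?_
    rw [div_eq_inv_mul]
    refine mul_le_mul_of_nonneg_left ?_ (by positivity)
    rw [mul_pow, Real.sq_sqrt hV.le, hVdef, ← M.integral_norm_sq_noise, ← integral_const_mul]
    refine integral_mono (integrable_of_abs_le (B := ((2 * m) ^ 2) ^ 2) fun y => ?_)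
      (hSA.integrable_norm_sq_e.const_mul _) fun y => ?_
    · rw [abs_of_nonneg (by positivity)]
      exact pow_le_pow_left₀ (norm_nonneg _) (hnn y) 2
    · simp only
      rw [frobenius_norm_vecMulVec, mul_pow]
      exact mul_le_mul_of_nonneg_right (pow_le_pow_left₀ (norm_nonneg _) (M.norm_noise_le y) 2)
        (sq_nonneg _)
  have c2 : ∫ x, f₂ x ^ 2 ∂Q ≤ 2 ^ 2 / T := by
    refine b2.trans ?_
    rw [div_eq_inv_mul]
    refine mul_le_mul_of_nonneg_left ?_ (by positivity)
    have := norm_integral_le_of_norm_le_const (μ := M.sampleLaw.toMeasure)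
      (f := fun y => ‖M.tdMatrix y.1 y.2.2‖ ^ 2) (C := 2 ^ 2) (ae_of_all _ fun y => by
        rw [Real.norm_of_nonneg (by positivity)]
        exact pow_le_pow_left₀ (norm_nonneg _) (M.norm_tdMatrix_le y.1 y.2.2) 2)
    simp only [probReal_univ, mul_one] at this
    exact (le_abs_self _).trans this
  have hf₃eq : ∀ x, f₃ x = ‖(T : ℝ)⁻¹ • ∑ t ∈ Finset.range T,
      saError (fun x => toEuclideanCLM (n := Fin d) (𝕜 := ℝ) (M.sampleA x))
        (fun x => WithLp.toLp 2 (M.noise x)) (fun t => η₀ * ((t + 1 : ℕ) : ℝ) ^ (-α))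
        (WithLp.toLp 2 (θ₀ - M.thetaStar)) x (t + 1)‖ := fun x => by
    rw [hf₃]; simp only; rw [M.avgIterate_sub_thetaStar η₀ α θ₀ x hT1]
  -- The value `9/4` is chosen because `(9/4)² = 81/16 ≥ 5`.
  have c3 : ∫ x, f₃ x ^ 2 ∂Q ≤ (9 / 4 * K) ^ 2 / T := by
    simp_rw [hf₃eq]
    refine hT.trans ?_
    rw [M.integral_norm_sq_noise, ← hVdef, hK, mul_comm M.lambdaZero]
    set κ := (1 - M.discount) * M.lambdaZero
    rw [mul_pow (9 / 4 : ℝ), div_pow (√V), Real.sq_sqrt hV.le, div_le_div_iff₀ (by positivity) hT0]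
    have : ((9 : ℝ) / 4) ^ 2 * (V / κ ^ 2) * (κ ^ 2 * T) = 81 / 16 * V * T := by
      field_simp; norm_num
    rw [this]
    nlinarith [mul_pos hV hT0]
  have hdep₁ : DependsOn f₁ (Finset.range T : Set ℕ) := fun x y h => by
    simp only [hf₁]
    congr 3
    exact Finset.sum_congr rfl fun t ht => by rw [h t (by simpa using ht)]
  have hdep₂ : DependsOn f₂ (Finset.range T : Set ℕ) := fun x y h => by
    simp only [hf₂, avgA]
    congr 3
    exact Finset.sum_congr rfl fun t ht => by rw [h t (by simpa using ht)]
  have hdep₃ : DependsOn f₃ (Finset.range (T + 1) : Set ℕ) := fun x y h => by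
    rw [hf₃eq, hf₃eq]
    congr 2
    exact Finset.sum_congr rfl fun t ht => saError_dependsOn (t + 1) fun i hi =>
      h i (by simp at hi ht ⊢; omega)
  have i3 : Integrable (fun x => f₃ x ^ 2) Q := by
    choose B hB using fun t => saError_bounded (η := fun t => η₀ * ((t + 1 : ℕ) : ℝ) ^ (-α))
      (δ₀ := WithLp.toLp 2 (θ₀ - M.thetaStar)) hSA.norm_le hSA.noise_le t
    refine integrable_of_dependsOn _ (s := Finset.range (T + 1))
      (fun x y h => by simp only [hdep₃ h])
      (B := ((T : ℝ)⁻¹ * ∑ t ∈ Finset.range T, B (t + 1)) ^ 2) fun x => ?_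
    rw [Real.norm_of_nonneg (by positivity), hf₃eq, norm_smul, Real.norm_of_nonneg (by positivity)]
    gcongr
    exact (norm_sum_le _ _).trans (Finset.sum_le_sum fun t _ => hB (t + 1) x)
  have p1 := measureReal_gt_le_of_integral_sq_le i1 (by positivity) hT1 c1
  have p2 := measureReal_gt_le_of_integral_sq_le i2 (by positivity) hT1 c2
  have p3 := measureReal_gt_le_of_integral_sq_le i3 (by positivity) hT1 c3
  set B₁ : Set (ℕ → S × A × S) := {x | 2 * m * √V * τ < f₁ x} with hB₁
  set B₂ : Set (ℕ → S × A × S) := {x | 2 * τ < f₂ x} with hB₂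
  set B₃ : Set (ℕ → S × A × S) := {x | 9 / 4 * K * τ < f₃ x} with hB₃
  change Q.real B₁ ≤ τ at p1
  change Q.real B₂ ≤ τ at p2
  change Q.real B₃ ≤ τ at p3
  have hmeas : MeasurableSet (B₁ ∪ B₂ ∪ B₃) :=
    ((measurableSet_lt measurable_const hdep₁.measurable_of_discrete).union
      (measurableSet_lt measurable_const hdep₂.measurable_of_discrete)).union
      (measurableSet_lt measurable_const hdep₃.measurable_of_discrete)
  refine ⟨(B₁ ∪ B₂ ∪ B₃)ᶜ, hmeas.compl, ?_, fun x hx => ?_⟩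
  · rw [probReal_compl_eq_one_sub hmeas]
    have h1 := measureReal_union_le (μ := Q) (B₁ ∪ B₂) B₃
    have h2 := measureReal_union_le (μ := Q) B₁ B₂
    linarith
  · simp only [Set.mem_compl_iff, Set.mem_union, not_or, hB₁, hB₂, hB₃, Set.mem_ofPred_eq,
      not_lt] at hx
    exact M.tvDist_le_of_concentration hlam hdet η₀ α θ₀ x hT1 hτ0 hx.1.1 hx.1.2 hx.2 hTm

end TDProblem

end Main

/-! ### Transfer to an arbitrary i.i.d. sample and the choice of the remainder. -/

theorem theorem3 :
    ∃ C : ℝ, 0 < C ∧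
      ∀ (S A : Type*) [Countable S] [Countable A]
        [MeasurableSpace S] [DiscreteMeasurableSpace S]
        [MeasurableSpace A] [DiscreteMeasurableSpace A]
        (d : ℕ) (M : TDProblem S A d) (η₀ α : ℝ) (θ₀ : Fin d → ℝ),
        0 < M.lambdaZero → IsUnit M.noiseCov.det →
        0 < η₀ → η₀ < 1 / 2 → 1 / 2 < α → α < 1 →
        ∃ ρ : ℕ → ℝ, ρ =o[atTop] (fun T : ℕ => (T : ℝ) ^ (-(1 / 3) : ℝ)) ∧
          ∀ (Ω : Type*) [MeasurableSpace Ω] (P : Measure Ω) [IsProbabilityMeasure P]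
            (X : ℕ → Ω → S × A × S),
            (∀ t, Measurable (X t)) → iIndepFun X P →
            (∀ t, P.map (X t) = M.sampleLaw.toMeasure) →
            ∀ T : ℕ, 1 ≤ T →
              1 - 3 * (T : ℝ) ^ (-(1 / 3) : ℝ)
                  - √M.noiseCov.trace / (M.lambdaZero * (1 - M.discount) * √(T : ℝ))
                ≤ P.real {ω | tvDist
                    (centeredGaussian (M.estAsympCov η₀ α θ₀ (fun t => X t ω) T))
                    (centeredGaussian M.asympCov)
                  ≤ C * (√M.noiseCov.trace / (M.lambdaZero * (1 - M.discount))
                        * (euclNorm M.thetaStar + 1) * spectralNorm₂ M.noiseCov⁻¹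
                        * (T : ℝ) ^ (-(1 / 3) : ℝ))
                      + ρ T} := by
  refine ⟨150, by norm_num, ?_⟩
  intro S A _ _ _ _ _ _ d M η₀ α θ₀ hlam hdet hη₀ _ hα0 hα1
  obtain ⟨T₀, hT₀⟩ := eventually_atTop.1
    (M.eventually_concentration hlam hdet hη₀ (by linarith : 0 < α) hα1 θ₀)
  have hγ : 0 < 1 - M.discount := sub_pos.2 M.discount_lt_one
  -- `T₀` comes from the canonical product space, so `ρ` does not depend on the probability space
  -- carrying the sample. Being eventually zero, it is negligible at every rate.
  refine ⟨fun T => if T < T₀ then 1 else 0, ?_, ?_⟩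
  · refine (isLittleO_zero _ _).congr' ?_ EventuallyEq.rfl
    filter_upwards [eventually_ge_atTop T₀] with T hT
    rw [if_neg (not_lt.2 hT)]
  intro Ω _ P _ X hX hind hlaw T hT
  -- The `1/√T` part of the allowed failure probability is simply given away; `3 T^(-1/3)` already
  -- suffices.
  have hp : 0 ≤ √M.noiseCov.trace / (M.lambdaZero * (1 - M.discount) * √(T : ℝ)) := by positivity
  have hr : 0 ≤ (T : ℝ) ^ (-(1 / 3) : ℝ) := Real.rpow_nonneg (Nat.cast_nonneg T) _
  by_cases hTT : T < T₀
  · have hb : 0 ≤ 150 * (√M.noiseCov.trace / (M.lambdaZero * (1 - M.discount))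
        * (euclNorm M.thetaStar + 1) * spectralNorm₂ M.noiseCov⁻¹
        * (T : ℝ) ^ (-(1 / 3) : ℝ)) := by
      have h1 : 0 ≤ euclNorm M.thetaStar := norm_nonneg _
      have h2 := spectralNorm₂_nonneg M.noiseCov⁻¹
      positivity
    have huniv : {ω | tvDist
        (centeredGaussian (M.estAsympCov η₀ α θ₀ (fun t => X t ω) T)) (centeredGaussian M.asympCov)
        ≤ 150 * (√M.noiseCov.trace / (M.lambdaZero * (1 - M.discount))
          * (euclNorm M.thetaStar + 1) * spectralNorm₂ M.noiseCov⁻¹ * (T : ℝ) ^ (-(1 / 3) : ℝ))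
          + if T < T₀ then 1 else 0} = Set.univ := by
      refine Set.eq_univ_of_forall fun ω => ?_
      rw [Set.mem_ofPred_eq, if_pos hTT]
      exact (tvDist_le_one _ _).trans (by linarith)
    rw [huniv, probReal_univ]
    linarith
  · obtain ⟨G, hG, hGp, hGt⟩ := hT₀ T (not_lt.1 hTT)
    -- Independence and the common marginal law determine the joint law of the sequence, so the good
    -- event can be pulled back.
    have hmap : P.map (fun ω t => X t ω) = Measure.infinitePi fun _ : ℕ => M.sampleLaw.toMeasure := by
      rw [(iIndepFun_iff_map_fun_eq_infinitePi_map hX).1 hind]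
      simp_rw [hlaw]
    rw [← hmap, map_measureReal_apply (measurable_pi_lambda _ hX) hG] at hGp
    have hsub := measureReal_mono (μ := P) (s₁ := (fun ω t => X t ω) ⁻¹' G) (s₂ := {ω | tvDist
        (centeredGaussian (M.estAsympCov η₀ α θ₀ (fun t => X t ω) T)) (centeredGaussian M.asympCov)
        ≤ 150 * (√M.noiseCov.trace / (M.lambdaZero * (1 - M.discount))
          * (euclNorm M.thetaStar + 1) * spectralNorm₂ M.noiseCov⁻¹ * (T : ℝ) ^ (-(1 / 3) : ℝ))
          + if T < T₀ then 1 else 0}) fun ω hω => by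
      rw [Set.mem_ofPred_eq, if_neg hTT, add_zero]
      exact hGt _ hω
    linarith
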